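/- Let $V=\bigoplus_{n\in\mathbf Z}V_n$ be a vertex operator algebra over $\mathbf C$ (with $\dim V_n<\infty$ and $V_n=0$ for $n\ll0$), with vacuum $\mathbf 1$, conformal vector $\omega$ and Virasoro operators $L(n)$, and assume that $V$ is of CFT type, i.e. $V_0=\mathbf C\mathbf 1$. Put $F_NV=\bigoplus_{n\le N}V_n$. For $\gamma=\begin{pmatrix}a&b\\c&d\end{pmatrix}\in SL_2(\mathbf Z)$ and $\tau$ in the upper half-plane $\mathcal H$ put $j(\gamma,\tau)=c\tau+d$ and $K(\gamma,\tau)=\exp(-c\,j(\gamma,\tau)L(1))\,j(\gamma,\tau)^{-2L(0)}$. For $k\in\mathbf Z$ let $M_k(V)$ be the space of functions $f:\mathcal H\to V$ which, for some $N$, are holomorphic maps to $F_NV$, satisfy $f(\gamma\tau)=j(\gamma,\tau)^kK(\gamma,\tau)f(\tau)$ for all $\gamma\in SL_2(\mathbf Z)$, and have an expansion in $F_NV[[q]]$, $q=e^{2\pi i\tau}$. Let $M_k$ be the space of scalar-valued modular forms of weight $k$ on $SL_2(\mathbf Z)$, regarded as a subspace of $M_k(V)$ by $f\mapsto f\mathbf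 1$, let $M_k(QP)=\{f\in M_k(V): L(1)f=0\}$, and let $$\nabla_kf=\frac{df}{d\tau}+L(-1)f-\frac{2\pi i k}{12}E_2f .$$ Theorem. For every integer $k$ the space $M_k(V)$ is finite-dimensional, $\nabla_{k-2}$ maps $M_{k-2}(V)$ linearly to $M_k(V)$ and $M_{k-2}$ into $M_k(QP)$, and the induced map $M_{k-2}(V)/M_{k-2}\to M_k(V)/M_k(QP)$ is injective. There is a subspace $R_k$ with $$M_k(V)/M_k(QP)=\nabla_{k-2}\big(M_{k-2}(V)/M_{k-2}\big)\oplus R_k ,$$ and, consequently, for any complement $W$ of $M_{k-2}$ in $M_{k-2}(V)$ (a realization of $M_{k-2}(V)/M_{k-2}$) there is a subspace $R_k$ of $M_k(V)$ with $$M_k(V)=M_k(QP)\oplus\nabla_{k-2}(W)\oplus R_k .$$ In either decomposition, every such $R_k$ satisfies $$\dim R_k=\dim M_{k-2}\cdot\big(\dim V_1-\dim\ker L(1)|_{V_1}\big).$$ In particular, if $V$ has a nondegenerate invariant bilinear form, i.e. a nondegenerate bilinear form with $(Y(a,z)b,c)=(b,Y(e^{zL(1)}(-z^{-2})^{L(0)}a,z^{-1})c)$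 for all $a,b,c\in V$, then $R_k=0$. -/

import Mathlib

open scoped VertexOperator MatrixGroups Manifold
open UpperHalfPlane

noncomputable section

/-- A vertex algebra over `ℂ`, in terms of the state-field correspondence `Y` and the Borcherds
(Jacobi) identity for the modes `a(n) = (Y a)[[n]]`, where `Y(a, z) = ∑ a(n) z ^ (-n - 1)`.
All sums have only finitely many nonzero terms, because `Y a` takes values in Laurent series. -/
structure VertexAlgebra (V : Type*) [AddCommGroup V] [Module ℂ V] where
  /-- the state-field correspondence -/
  Y : V →ₗ[ℂ] VertexOperator ℂ V
  /-- the vacuum `𝟏` -/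
  vac : V
  vac_ne_zero : vac ≠ 0
  /-- every field is creative -/
  creative : ∀ (a : V) (n : ℤ), 0 ≤ n → ((Y a)[[n]]) vac = 0
  /-- the field of `a` creates `a` -/
  creates : ∀ a : V, ((Y a)[[-1]]) vac = a
  jacobi : ∀ (a b c : V) (r s t : ℤ),
    (∑ᶠ i : ℕ, ((Ring.choose r i : ℤ) : ℂ) •
        ((Y (((Y a)[[t + i]]) b))[[r + s - i]]) c) =
      ∑ᶠ i : ℕ, ((-1 : ℂ) ^ i * ((Ring.choose t i : ℤ) : ℂ)) •
        (((Y a)[[r + t - i]]) (((Y b)[[s + i]]) c)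
          - (-1 : ℂ) ^ t • ((Y b)[[s + t - i]]) (((Y a)[[r + i]]) c))

/-- A `ℤ`-graded vertex algebra, with finite-dimensional homogeneous pieces `V_n = gr n` which
vanish for `n ≪ 0`. -/
structure GradedVertexAlgebra (V : Type*) [AddCommGroup V] [Module ℂ V] extends
    VertexAlgebra V where
  gr : ℤ → Submodule ℂ V
  isInternal : DirectSum.IsInternal gr
  mode_mem : ∀ (k l n : ℤ) (a b : V), a ∈ gr k → b ∈ gr l →
    ((Y a)[[n]]) b ∈ gr (k + l - n - 1)
  finite_gr : ∀ n, Module.Finite ℂ (gr n)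
  gr_bounded : ∃ n₀ : ℤ, ∀ n < n₀, gr n = ⊥

/-- A vertex operator algebra over `ℂ`: a `ℤ`-graded vertex algebra with a conformal vector `ω`
whose modes `L(n) = ω(n + 1)` satisfy the Virasoro relations, such that `L(0)` is the Euler operator
of the grading and `L(-1)` is the canonical derivation `a ↦ a(-2)𝟏`. (Translation covariance, and
the commutator formula of `L(1)` with modes, follow from the Jacobi identity.) -/
structure VertexOperatorAlgebra (V : Type*) [AddCommGroup V] [Module ℂ V] extends
    GradedVertexAlgebra V where
  /-- the conformal vector -/
  ω : V
  /-- the central charge -/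
  c : ℂ
  ω_mem : ω ∈ gr 2
  virasoro : ∀ m n : ℤ,
    (Y ω)[[m + 1]] * (Y ω)[[n + 1]] - (Y ω)[[n + 1]] * (Y ω)[[m + 1]] =
      ((m - n : ℤ) : ℂ) • (Y ω)[[m + n + 1]] +
        (if m + n = 0 then (((m : ℂ) ^ 3 - m) / 12 * c) • (1 : Module.End ℂ V) else 0)
  euler : ∀ (n : ℤ) (a : V), a ∈ gr n → ((Y ω)[[1]]) a = (n : ℂ) • a
  translation : ∀ a : V, ((Y ω)[[0]]) a = ((Y a)[[-2]]) vac

namespace VertexOperatorAlgebra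

variable {V : Type*} [AddCommGroup V] [Module ℂ V] (A : VertexOperatorAlgebra V)

/-- The mode `a(n)`. -/
def mode (a : V) (n : ℤ) : Module.End ℂ V := (A.Y a)[[n]]

/-- The Virasoro operator `L(n) = ω(n + 1)`. -/
def L (n : ℤ) : Module.End ℂ V := A.mode A.ω (n + 1)

/-- `V` is of CFT type: `V_0 = ℂ𝟏`. -/
def IsCFTType : Prop := A.gr 0 = Submodule.span ℂ {A.vac}

/-- An invariant bilinear form:
`(Y(a, z) b, c) = (b, Y(e^{z L(1)} (-z^{-2})^{L(0)} a, z^{-1}) c)`, written out in modes for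
homogeneous `a`. -/
def IsInvariantForm (B : LinearMap.BilinForm ℂ V) : Prop :=
  ∀ (h : ℤ) (a : V), a ∈ A.gr h → ∀ (n : ℤ) (b c : V),
    B (A.mode a n b) c =
      (-1 : ℂ) ^ h * ∑ᶠ j : ℕ, (1 / (j.factorial : ℂ)) *
        B b (A.mode ((A.L 1 ^ j) a) (2 * h - j - n - 2) c)

/-- The truncation `F_N V = ⨁_{n ≤ N} V_n`. -/
def F (N : ℤ) : Submodule ℂ V := ⨆ n : {n : ℤ // n ≤ N}, A.gr n

lemma F_mono {M N : ℤ} (h : M ≤ N) : A.F M ≤ A.F N :=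
  iSup_le fun n => le_iSup (fun m : {m : ℤ // m ≤ N} => A.gr m) ⟨n.1, n.2.trans h⟩

lemma L_one_pow_mem {n : ℤ} {v : V} (hv : v ∈ A.gr n) (i : ℕ) :
    (A.L 1 ^ i) v ∈ A.gr (n - i) := by
  induction i with
  | zero => simpa using hv
  | succ i ih =>
    rw [pow_succ', Module.End.mul_apply]
    have := A.mode_mem 2 (n - i) (1 + 1) A.ω _ A.ω_mem ih
    have e : (2 : ℤ) + (n - i) - (1 + 1) - 1 = n - ((i + 1 : ℕ) : ℤ) := by push_cast; ring
    rw [e] at this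
    exact this

/-- `L(1)` is locally nilpotent. -/
lemma L_one_locally_nilpotent (v : V) : ∃ N : ℕ, ∀ i ≥ N, (A.L 1 ^ i) v = 0 := by
  obtain ⟨n₀, hn₀⟩ := A.gr_bounded
  have hv : v ∈ ⨆ n, A.gr n := by
    rw [A.isInternal.submodule_iSup_eq_top]; trivial
  induction hv using Submodule.iSup_induction' with
  | mem n x hx =>
    refine ⟨(n - n₀ + 1).toNat, fun i hi => ?_⟩
    have h := A.L_one_pow_mem hx i
    rw [hn₀ _ (by omega)] at h
    simpa using h
  | zero => exact ⟨0, fun i _ => by simp⟩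
  | add x y _ _ hx hy =>
    obtain ⟨M, hM⟩ := hx
    obtain ⟨N, hN⟩ := hy
    exact ⟨max M N, fun i hi => by
      rw [map_add, hM i (le_trans (le_max_left _ _) hi), hN i (le_trans (le_max_right _ _) hi),
        add_zero]⟩

lemma expL1_support (x : ℂ) (v : V) :
    (Function.support fun i : ℕ => (x ^ i / (i.factorial : ℂ)) • (A.L 1 ^ i) v).Finite := by
  obtain ⟨N, hN⟩ := A.L_one_locally_nilpotent v
  refine (Set.finite_lt_nat N).subset fun i hi => ?_
  by_contra h
  exact hi (by simp [hN i (not_lt.mp h)])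

/-- The operator `exp(x L(1)) = ∑ x^i / i! L(1)^i`, a finite sum on every vector. -/
def expL1 (x : ℂ) : Module.End ℂ V where
  toFun v := ∑ᶠ i : ℕ, (x ^ i / (i.factorial : ℂ)) • (A.L 1 ^ i) v
  map_add' v w := by
    rw [← finsum_add_distrib (A.expL1_support x v) (A.expL1_support x w)]
    simp only [map_add, smul_add]
  map_smul' r v := by
    simp only [map_smul, RingHom.id_apply]
    rw [smul_finsum' r (A.expL1_support x v)]
    simp only [smul_comm r]

/-- The decomposition `V ≃ ⨁ V_n`. -/
def decomp : V ≃ₗ[ℂ] DirectSum ℤ fun n => A.gr n :=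
  (LinearEquiv.ofBijective (DirectSum.coeLinearMap A.gr) (by exact A.isInternal)).symm

lemma decomp_of_mem {n : ℤ} {v : V} (hv : v ∈ A.gr n) :
    A.decomp v = DirectSum.lof ℂ ℤ (fun n => A.gr n) n ⟨v, hv⟩ := by
  rw [decomp, LinearEquiv.symm_apply_eq]
  exact (DirectSum.coeLinearMap_lof (R := ℂ) A.gr n ⟨v, hv⟩).symm

/-- The operator `x^{L(0)}`, which is multiplication by `x^n` on `V_n`. -/
def powL0 (x : ℂ) : Module.End ℂ V :=
  (DirectSum.toModule ℂ ℤ V fun n => (x ^ n) • (A.gr n).subtype) ∘ₗ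
    A.decomp.toLinearMap

lemma powL0_of_mem (x : ℂ) {n : ℤ} {v : V} (hv : v ∈ A.gr n) : A.powL0 x v = x ^ n • v := by
  simp only [powL0, LinearMap.comp_apply, LinearEquiv.coe_coe, A.decomp_of_mem hv]
  simp [DirectSum.toModule_lof]

/-- The canonical cocycle `K(γ, τ) = exp(-c j(γ, τ) L(1)) j(γ, τ)^{-2 L(0)}` for `γ ∈ SL₂(ℤ)`
with lower row `(c, d)`, where `j(γ, τ) = c τ + d`. -/
def K (γ : SL(2, ℤ)) (τ : ℍ) : Module.End ℂ V :=
  A.expL1 (-(γ 1 0 : ℂ) * denom γ τ) * A.powL0 (denom γ τ ^ (-2 : ℤ))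

/-- `f` is a holomorphic `V`-valued modular form of weight `k` and conformal degree at most `N`.
As `F_N V` is finite-dimensional, holomorphy and convergence may be tested on linear functionals. -/
structure IsModularForm (k N : ℤ) (f : ℍ → V) : Prop where
  mem : ∀ τ, f τ ∈ A.F N
  holo : ∀ φ : Module.Dual ℂ V, MDiff (fun τ => φ (f τ))
  modular : ∀ (γ : SL(2, ℤ)) (τ : ℍ), f (γ • τ) = denom γ τ ^ k • A.K γ τ (f τ)
  /-- `f` has a `q`-expansion in `F_N V⟦q⟧` -/
  qExp : ∃ a : ℕ → V, (∀ n, a n ∈ A.F N) ∧ ∀ (φ : Module.Dual ℂ V) (τ : ℍ),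
    HasSum (fun n => φ (a n) * Complex.exp (2 * Real.pi * Complex.I * τ) ^ n) (φ (f τ))

variable {A} in
lemma IsModularForm.mono {k M N : ℤ} {f : ℍ → V} (hf : A.IsModularForm k M f) (h : M ≤ N) :
    A.IsModularForm k N f where
  mem τ := A.F_mono h (hf.mem τ)
  holo := hf.holo
  modular := hf.modular
  qExp := by
    obtain ⟨a, ha, ha'⟩ := hf.qExp
    exact ⟨a, fun n => A.F_mono h (ha n), ha'⟩

/-- The space `M_k(V)` of holomorphic `V`-valued modular forms of weight `k`. -/
def modForms (k : ℤ) : Submodule ℂ (ℍ → V) where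
  carrier := {f | ∃ N, A.IsModularForm k N f}
  zero_mem' := ⟨0,
    { mem := fun _ => Submodule.zero_mem _
      holo := fun φ => by simpa using! mdifferentiable_const
      modular := fun γ τ => by simp
      qExp := ⟨0, fun _ => Submodule.zero_mem _, fun φ τ => by simp⟩ }⟩
  add_mem' := by
    rintro f g ⟨M, hf⟩ ⟨N, hg⟩
    have hf := hf.mono (le_max_left M N)
    have hg := hg.mono (le_max_right M N)
    refine ⟨max M N, ⟨fun τ => Submodule.add_mem _ (hf.mem τ) (hg.mem τ), fun φ => ?_,
      fun γ τ => ?_, ?_⟩⟩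
    · simpa using! (hf.holo φ).add (hg.holo φ)
    · rw [Pi.add_apply, Pi.add_apply, hf.modular, hg.modular, map_add, smul_add]
    · obtain ⟨a, ha, ha'⟩ := hf.qExp
      obtain ⟨b, hb, hb'⟩ := hg.qExp
      refine ⟨a + b, fun n => Submodule.add_mem _ (ha n) (hb n), fun φ τ => ?_⟩
      simpa [add_mul] using (ha' φ τ).add (hb' φ τ)
  smul_mem' := by
    rintro c f ⟨N, hf⟩
    refine ⟨N, ⟨fun τ => Submodule.smul_mem _ _ (hf.mem τ), fun φ => ?_,
      fun γ τ => ?_, ?_⟩⟩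
    · simpa using! (hf.holo φ).const_smul c
    · rw [Pi.smul_apply, Pi.smul_apply, hf.modular, map_smul, smul_comm c]
    · obtain ⟨a, ha, ha'⟩ := hf.qExp
      refine ⟨c • a, fun n => Submodule.smul_mem _ _ (ha n), fun φ τ => ?_⟩
      simpa [mul_assoc] using (ha' φ τ).mul_left c

lemma vac_mem : A.vac ∈ A.gr 0 := by
  have h0 : A.L 0 A.vac = 0 := A.creative A.ω 1 (by norm_num)
  have key : ∀ (v : V) (n : ℤ), (A.decomp (A.L 0 v) n : V) = (n : ℂ) • (A.decomp v n : V) := by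
    intro v n
    have hv : v ∈ ⨆ n, A.gr n := by
      rw [A.isInternal.submodule_iSup_eq_top]; trivial
    induction hv using Submodule.iSup_induction' with
    | mem m x hx =>
      have he : A.L 0 x = (m : ℂ) • x := A.euler m x hx
      rw [he, map_smul, A.decomp_of_mem hx, DirectSum.smul_apply, Submodule.coe_smul]
      by_cases hmn : n = m
      · rw [hmn]
      · have : (DirectSum.lof ℂ ℤ (fun n => A.gr n) m ⟨x, hx⟩) n = 0 :=
          DirectSum.of_eq_of_ne m n _ hmn
        simp [this]
    | zero => simp
    | add x y _ _ hx hy =>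
      simp only [map_add, DirectSum.add_apply, Submodule.coe_add, hx, hy, smul_add]
  have hz : ∀ n : ℤ, n ≠ 0 → A.decomp A.vac n = 0 := by
    intro n hn
    have := key A.vac n
    rw [h0] at this
    have h := this.symm
    simp only [map_zero, DirectSum.zero_apply, Submodule.coe_zero, smul_eq_zero,
      Int.cast_eq_zero, hn, false_or] at h
    exact Subtype.ext h
  have hx0 : A.decomp A.vac = DirectSum.lof ℂ ℤ (fun n => A.gr n) 0 (A.decomp A.vac 0) := by
    refine DFinsupp.ext fun n => ?_
    by_cases hn : n = 0
    · rw [hn]; exact (DirectSum.of_eq_same (β := fun n => A.gr n) 0 _).symm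
    · exact (hz n hn).trans (DirectSum.of_eq_of_ne (β := fun n => A.gr n) 0 n _ hn).symm
  have h1 : A.decomp ((A.decomp A.vac 0 : A.gr 0) : V) = A.decomp A.vac := by
    rw [A.decomp_of_mem (A.decomp A.vac 0).2]; exact hx0.symm
  rw [← A.decomp.injective h1]
  exact (A.decomp A.vac 0).2

lemma K_vac (γ : SL(2, ℤ)) (τ : ℍ) : A.K γ τ A.vac = A.vac := by
  have h1 : A.L 1 A.vac = 0 := A.creative A.ω (1 + 1) (by norm_num)
  have h2 : ∀ x, A.expL1 x A.vac = A.vac := by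
    intro x
    change (∑ᶠ i : ℕ, (x ^ i / (i.factorial : ℂ)) • (A.L 1 ^ i) A.vac) = A.vac
    rw [finsum_eq_single _ 0]
    · simp
    · intro i hi
      obtain ⟨j, rfl⟩ := Nat.exists_eq_succ_of_ne_zero hi
      simp [pow_succ, h1]
  simp [K, A.powL0_of_mem _ A.vac_mem, h2]

/-- The embedding `M_k → M_k(V)`, `f ↦ f 𝟏`, of scalar-valued modular forms of level one. -/
def vacForm (k : ℤ) : ModularForm 𝒮ℒ k →ₗ[ℂ] A.modForms k where
  toFun f := ⟨fun τ => f τ • A.vac, 0,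
    { mem := fun τ => Submodule.smul_mem _ _
        (le_iSup (fun m : {m : ℤ // m ≤ 0} => A.gr m) ⟨0, le_rfl⟩ A.vac_mem)
      holo := fun φ => by
        simpa [mul_comm] using! (f.holo').const_smul (φ A.vac)
      modular := fun γ τ => by
        have h : f (γ • τ) = denom γ τ ^ k * f τ := by
          have : SlashInvariantFormClass (ModularForm 𝒮ℒ k)
              ((CongruenceSubgroup.Gamma 1).map (Matrix.SpecialLinearGroup.mapGL ℝ)) k :=
            CongruenceSubgroup.Gamma_one_coe_eq_SL ▸ inferInstance
          exact SlashInvariantForm.slash_action_eqn_SL'' f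
            (CongruenceSubgroup.mem_Gamma_one γ) τ
        change f (γ • τ) • A.vac = _ • A.K γ τ (f τ • A.vac)
        rw [LinearMap.map_smul, A.K_vac, h, mul_smul]
      qExp := ⟨fun n => (qExpansion 1 f).coeff n • A.vac, fun n => Submodule.smul_mem _ _
        (le_iSup (fun m : {m : ℤ // m ≤ 0} => A.gr m) ⟨0, le_rfl⟩ A.vac_mem), fun φ τ => by
          have := ModularForm.hasSum_qExpansion f one_pos one_mem_strictPeriods_SL τ
          simpa [Function.Periodic.qParam, mul_assoc, mul_comm, mul_left_comm] using
            this.mul_right (φ A.vac)⟩ }⟩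
  map_add' f g := by ext τ; simp [add_smul]
  map_smul' c f := by ext τ; simp [mul_smul]

/-- `M_k` as a subspace of `M_k(V)`. -/
def scalarForms (k : ℤ) : Submodule ℂ (A.modForms k) := LinearMap.range (A.vacForm k)

/-- `M_k(QP)`: the elements of `M_k(V)` in the kernel of `L(1)`. -/
def quasiPrimaryForms (k : ℤ) : Submodule ℂ (A.modForms k) where
  carrier := {f | ∀ τ, A.L 1 ((f : ℍ → V) τ) = 0}
  zero_mem' _ := by simp
  add_mem' hf hg τ := by simp [hf τ, hg τ]
  smul_mem' c f hf τ := by simp [hf τ]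

/-- The derivative `df/dτ` of a function with values in a finite-dimensional subspace of `V`:
the vector whose image under every linear functional `φ` is the derivative of `φ ∘ f`. -/
def vDeriv (f : ℍ → V) (τ : ℍ) : V :=
  Classical.epsilon fun w => ∀ φ : Module.Dual ℂ V,
    HasDerivAt (fun z : ℂ => φ (f (ofComplex z))) (φ w) τ

/-- The modular derivative `∇_k f = df/dτ + L(-1) f - (2πi k / 12) E₂ f`. -/
def nabla (k : ℤ) (f : ℍ → V) (τ : ℍ) : V :=
  vDeriv f τ + A.L (-1) (f τ) -
    (2 * Real.pi * Complex.I * k / 12 * EisensteinSeries.E2 τ) • f τ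

end VertexOperatorAlgebra

end

noncomputable section

namespace VertexOperatorAlgebra

variable {V : Type*} [AddCommGroup V] [Module ℂ V] (A : VertexOperatorAlgebra V)

/-! Put φ = -(2πi/12) E₂. Its anomaly under `SL(2, ℤ)` matches the exponent in the cocycle `K`, so f
↦ exp(-φ L(1)) f turns a form of weight k into a function whose V_n-component is an ordinary modular
form of weight k - 2n (`IsModularForm.untwist`, `IsGradedForm.twist`). In CFT type V_n = 0 for n <
0, and nonzero forms of negative weight do not exist, so only 0 ≤ n ≤ k/2 contribute and M_k(V) is
finite-dimensional.

Dimensions come from L(1) rather than from ∇. As L(1) commutes with the twist, it maps M_k(V) to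
M_{k-2}(V) with kernel M_k(QP), and its image is computed weight by weight in V. An sl₂ argument
makes L(1)L(-1) bijective on V_n for n ≥ 1, so L(1) : V_{n+1} → V_n is onto there; into V_0 = ℂ𝟏 it
is either zero or onto. The image is accordingly a complement of M_{k-2} or all of M_{k-2}(V), and
the defect dim V_1 - dim ker L(1)|_{V_1}, which is 0 or 1, tells the cases apart
(`finrank_modForms`).

For ∇, the anomalies of d/dτ, L(-1) and E₂ cancel. If L(1)∇f = 0, a top component f_n with n ≥ 1
satisfies L(1)L(-1)f_n = 0 and so vanishes; hence f is scalar, which gives injectivity modulo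
M_{k-2} (`nablaMap_mem_quasiPrimaryForms_iff`). Comparing dimensions determines dim R_k. A
nondegenerate invariant form makes L(1) and L(-1) adjoint and forces the defect to be 0. -/

lemma homogeneous_induction {p : V → Prop} (mem : ∀ n, ∀ v ∈ A.gr n, p v) (zero : p 0)
    (add : ∀ v w, p v → p w → p (v + w)) (v : V) : p v := by
  have hv : v ∈ ⨆ n, A.gr n := by
    rw [A.isInternal.submodule_iSup_eq_top]; trivial
  induction hv using Submodule.iSup_induction' with
  | mem n x hx => exact mem n x hx
  | zero => exact zero
  | add x y _ _ hx hy => exact add x y hx hy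

/-! ### The sl₂-triple L(-1), L(0), L(1) in CFT type -/

lemma L_mem (m : ℤ) {n : ℤ} {v : V} (hv : v ∈ A.gr n) : A.L m v ∈ A.gr (n - m) := by
  have := A.mode_mem 2 n (m + 1) A.ω v A.ω_mem hv
  rwa [show 2 + n - (m + 1) - 1 = n - m by ring] at this

lemma L_zero_of_mem {n : ℤ} {v : V} (hv : v ∈ A.gr n) : A.L 0 v = (n : ℂ) • v :=
  A.euler n v hv

lemma L_vac {n : ℤ} (hn : -1 ≤ n) : A.L n A.vac = 0 := A.creative A.ω (n + 1) (by omega)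

/-- The Virasoro relation for modes without central term. -/
lemma L_comm (m n : ℤ) (h : (m : ℂ) ^ 3 - m = 0 ∨ m + n ≠ 0) (v : V) :
    A.L m (A.L n v) = A.L n (A.L m v) + ((m - n : ℤ) : ℂ) • A.L (m + n) v := by
  have := congrArg (fun T : Module.End ℂ V => T v) (A.virasoro m n)
  have hz : (if m + n = 0 then (((m : ℂ) ^ 3 - m) / 12 * A.c) • (1 : Module.End ℂ V) else 0) =
      0 := by
    split_ifs with h'
    · rcases h with h | h
      · simp [h]
      · exact absurd h' h
    · rfl
  rw [hz, add_zero] at this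
  simp only [LinearMap.sub_apply, Module.End.mul_apply, LinearMap.smul_apply] at this
  simp only [L, mode]
  rw [← this]
  abel

lemma L_one_L_neg_one (v : V) : A.L 1 (A.L (-1) v) = A.L (-1) (A.L 1 v) + (2 : ℂ) • A.L 0 v := by
  simpa using A.L_comm 1 (-1) (by simp) v

lemma L_neg_one_pow_mem {n : ℤ} {v : V} (hv : v ∈ A.gr n) (i : ℕ) :
    (A.L (-1) ^ i) v ∈ A.gr (n + i) := by
  induction i with
  | zero => simpa using hv
  | succ i ih =>
    rw [pow_succ', Module.End.mul_apply]
    have := A.L_mem (-1) ih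
    rwa [show n + (i : ℤ) - -1 = n + ((i + 1 : ℕ) : ℤ) by push_cast; ring] at this

/-- The action of `L(1) L(-1)^m` on a lowest weight vector of weight `n`. -/
lemma L_one_L_neg_one_pow {n : ℤ} {v : V} (hv : v ∈ A.gr n) (h1 : A.L 1 v = 0) (m : ℕ) :
    A.L 1 ((A.L (-1) ^ (m + 1)) v) =
      (((m + 1) * (2 * n + m) : ℤ) : ℂ) • (A.L (-1) ^ m) v := by

  induction m with
  | zero => simp [L_one_L_neg_one, h1, A.L_zero_of_mem hv, smul_smul]
  | succ m ih =>
    rw [pow_succ' _ (m + 1), Module.End.mul_apply, L_one_L_neg_one, ih, map_smul,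
      A.L_zero_of_mem (A.L_neg_one_pow_mem hv (m + 1)), ← Module.End.mul_apply, ← pow_succ', smul_smul,
      ← add_smul]
    congr 1
    push_cast
    ring

/-- A vertex operator algebra of CFT type has no states of negative weight. -/
lemma gr_neg (hA : A.IsCFTType) {n : ℤ} (hn : n < 0) : A.gr n = ⊥ := by
  obtain ⟨n₀, hn₀⟩ := A.gr_bounded
  have key : ∀ j : ℕ, ∀ n : ℤ, n < 0 → n < n₀ + j → A.gr n = ⊥ := by
    intro j
    induction j with
    | zero => intro n _ h; exact hn₀ n (by simpa using h)
    | succ j ih =>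
      intro n hn h
      rw [Submodule.eq_bot_iff]
      intro v hv
      have h1 : A.L 1 v = 0 := by
        have := A.L_mem 1 hv
        rw [ih (n - 1) (by omega) (by push_cast at h; omega)] at this
        simpa using this
      obtain ⟨m, rfl⟩ : ∃ m : ℕ, n = -(m + 1 : ℕ) := ⟨(-n - 1).toNat, by omega⟩

      -- In weight n = -(m + 1) the factor 2n + i is negative for i ≤ m, so L(1) can be used to
      -- strip one L(-1) at a time.
      have hdesc : ∀ i : ℕ, i ≤ m → A.L 1 ((A.L (-1) ^ (i + 1)) v) = 0 →
          (A.L (-1) ^ i) v = 0 := by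
        intro i hi h0
        rw [A.L_one_L_neg_one_pow hv h1] at h0
        refine (smul_eq_zero.mp h0).resolve_left ?_
        exact Int.cast_ne_zero.mpr <| mul_ne_zero (by omega) (by push_cast; omega)
      -- L(-1)^{m+1} v has weight 0, hence is a multiple of the vacuum. This starts the descent to v
      -- = 0.
      have htop : A.L 1 ((A.L (-1) ^ (m + 1)) v) = 0 := by
        have h0 := A.L_neg_one_pow_mem hv (m + 1)
        rw [neg_add_cancel, hA, Submodule.mem_span_singleton] at h0
        obtain ⟨a, ha⟩ := h0
        rw [← ha, map_smul, A.L_vac (by norm_num), smul_zero]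
      have hall : ∀ i : ℕ, i ≤ m → (A.L (-1) ^ (m - i)) v = 0 := by
        intro i
        induction i with
        | zero => intro _; exact hdesc m le_rfl htop
        | succ i ih' =>
          intro hi
          refine hdesc _ (by omega) ?_
          rw [show m - (i + 1) + 1 = m - i by omega, ih' (by omega), map_zero]
      simpa using hall m le_rfl
  exact key (n - n₀ + 1).toNat n hn (by omega)

/-- Passing from v to L(1)v lowers the weight to some n and replaces r by r + 2n, which stays
positive. The descent ends in V_{-1} = 0. -/
lemma eq_zero_of_L_neg_one_L_one (hA : A.IsCFTType) (n : ℕ) {v : V} (hv : v ∈ A.gr n) {r : ℕ}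
    (hr : r ≠ 0) (h : A.L (-1) (A.L 1 v) = -(r : ℂ) • v) : v = 0 := by
  induction n generalizing v r with
  | zero =>
    have h1 := A.L_mem 1 hv
    rw [A.gr_neg hA (by simp), Submodule.mem_bot] at h1
    rw [h1, map_zero] at h
    exact (smul_eq_zero.mp h.symm).resolve_left (by simpa using hr)
  | succ n ih =>
    have hu : A.L 1 v ∈ A.gr n := by simpa using A.L_mem 1 hv
    have h0 : A.L 1 v = 0 := by
      refine ih hu (r := r + 2 * n) (by omega) ?_
      have h2 := A.L_one_L_neg_one (A.L 1 v)
      rw [h, A.L_zero_of_mem hu, map_smul, smul_smul, ← sub_eq_iff_eq_add] at h2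
      rw [← h2, ← sub_smul]
      congr 1
      push_cast
      ring
    rw [h0, map_zero] at h
    exact (smul_eq_zero.mp h.symm).resolve_left (by simpa using hr)

/-- By [L(1), L(-1)] = 2L(0) the hypothesis is the eigenvalue equation of
`eq_zero_of_L_neg_one_L_one` with r = 2n. The vacuum shows that n ≥ 1 is needed. -/
lemma eq_zero_of_L_one_L_neg_one (hA : A.IsCFTType) {n : ℤ} (hn : 1 ≤ n) {v : V}
    (hv : v ∈ A.gr n) (h : A.L 1 (A.L (-1) v) = 0) : v = 0 := by
  lift n to ℕ using by omega
  refine A.eq_zero_of_L_neg_one_L_one hA n hv (r := 2 * n) (by omega) ?_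
  rw [L_one_L_neg_one, A.L_zero_of_mem hv, smul_smul] at h
  rw [eq_neg_of_add_eq_zero_left h]
  push_cast
  module

/-- L(1)L(-1) is an injective endomorphism of the finite-dimensional V_n, hence surjective. -/
lemma exists_L_one_eq (hA : A.IsCFTType) {n : ℤ} (hn : 1 ≤ n) {v : V} (hv : v ∈ A.gr n) :
    ∃ u ∈ A.gr (n + 1), A.L 1 u = v := by
  have hmap : ∀ u ∈ A.gr n, (A.L 1 * A.L (-1)) u ∈ A.gr n := fun u hu => by
    simpa using A.L_mem 1 (A.L_mem (-1) hu)
  have := A.finite_gr n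
  have hinj : Function.Injective ((A.L 1 * A.L (-1)).restrict hmap) := by
    rw [← LinearMap.ker_eq_bot, LinearMap.ker_eq_bot']
    intro u hu
    exact Subtype.ext (A.eq_zero_of_L_one_L_neg_one hA hn u.2 (congrArg Subtype.val hu))
  obtain ⟨u, hu⟩ := LinearMap.injective_iff_surjective.mp hinj ⟨v, hv⟩
  exact ⟨A.L (-1) u, by simpa using A.L_mem (-1) u.2, congrArg Subtype.val hu⟩

/-- A graded right inverse of `L(1)`, as far as one exists. -/
lemma exists_section_L_one : ∃ s : V →ₗ[ℂ] V, (∀ n, ∀ v ∈ A.gr n, s v ∈ A.gr (n + 1)) ∧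
    ∀ n, (∀ v ∈ A.gr n, ∃ u ∈ A.gr (n + 1), A.L 1 u = v) → ∀ v ∈ A.gr n, A.L 1 (s v) = v := by
  have h : ∀ n, ∃ t : A.gr n →ₗ[ℂ] A.gr (n + 1),
      (∀ v ∈ A.gr n, ∃ u ∈ A.gr (n + 1), A.L 1 u = v) → ∀ v, A.L 1 (t v) = v := by
    intro n
    by_cases hn : ∀ v ∈ A.gr n, ∃ u ∈ A.gr (n + 1), A.L 1 u = v
    · have hmap : ∀ u ∈ A.gr (n + 1), A.L 1 u ∈ A.gr n := fun u hu => by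
        simpa using A.L_mem 1 hu
      obtain ⟨t, ht⟩ := LinearMap.exists_rightInverse_of_surjective ((A.L 1).restrict hmap)
        (LinearMap.range_eq_top.mpr fun v => by
          obtain ⟨u, hu, huv⟩ := hn v v.2
          exact ⟨⟨u, hu⟩, Subtype.ext huv⟩)
      exact ⟨t, fun _ v => congrArg Subtype.val (LinearMap.congr_fun ht v)⟩
    -- Where L(1) is not onto, the section is zero; only its degree matters there.
    · exact ⟨0, fun h => absurd h hn⟩
  choose t ht using h
  let s : V →ₗ[ℂ] V :=
    DirectSum.toModule ℂ ℤ V (fun n => (A.gr (n + 1)).subtype ∘ₗ t n) ∘ₗ A.decomp.toLinearMap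
  have hs : ∀ n v, (hv : v ∈ A.gr n) → s v = t n ⟨v, hv⟩ := fun n v hv => by
    simp [s, A.decomp_of_mem hv, DirectSum.toModule_lof]
  exact ⟨s, fun n v hv => by rw [hs n v hv]; exact (t n _).2,
    fun n hn v hv => by rw [hs n v hv]; exact ht n hn ⟨v, hv⟩⟩

/-! ### Invariant bilinear forms -/

lemma L_one_ω : A.L 1 A.ω = 0 := by
  have h : A.L (-2) A.vac = A.ω := A.creates A.ω
  have := A.L_comm 1 (-2) (by simp) A.vac
  rw [h, A.L_vac (n := 1) (by norm_num)] at this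
  rw [this]
  simp [A.L_vac (n := -1) le_rfl]

/-- Since ω is quasi-primary, only the term j = 0 of the invariance formula survives. -/
lemma IsInvariantForm.L_adjoint {A : VertexOperatorAlgebra V} {B : LinearMap.BilinForm ℂ V}
    (hB : A.IsInvariantForm B) (n : ℤ) (b c : V) : B (A.L n b) c = B b (A.L (-n) c) := by
  have := hB 2 A.ω A.ω_mem (n + 1) b c
  rw [finsum_eq_single _ 0] at this
  · rw [show (2 * 2 - ((0 : ℕ) : ℤ) - (n + 1) - 2 : ℤ) = -n + 1 by push_cast; ring] at this
    simpa [L] using this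
  · intro j hj
    obtain ⟨i, rfl⟩ := Nat.exists_eq_succ_of_ne_zero hj
    simp [pow_succ, L_one_ω, mode]

/-- A nondegenerate invariant form forces `L(1)` to vanish on `V_1`. -/
lemma IsInvariantForm.L_one_eq_zero {A : VertexOperatorAlgebra V} {B : LinearMap.BilinForm ℂ V}
    (hB : A.IsInvariantForm B) (hn : B.Nondegenerate) (hA : A.IsCFTType) {v : V}
    (hv : v ∈ A.gr 1) : A.L 1 v = 0 := by
  have h0 : A.L 1 v ∈ A.gr 0 := by simpa using A.L_mem 1 hv
  rw [hA, Submodule.mem_span_singleton] at h0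
  obtain ⟨a, ha⟩ := h0
  by_contra hne
  have ha0 : a ≠ 0 := by rintro rfl; exact hne (by simpa using ha.symm)
  -- With L(1)v = a𝟏: a(𝟏, 𝟏) = (𝟏, L(1)v) = (L(-1)𝟏, v) = 0.
  have h1 : B A.vac A.vac = 0 := by
    have h := hB.L_adjoint (-1) A.vac v
    rw [A.L_vac le_rfl, map_zero, LinearMap.zero_apply, neg_neg, ← ha, map_smul] at h
    exact (smul_eq_zero.mp h.symm).resolve_left ha0
  refine A.vac_ne_zero (hn.1 A.vac (A.homogeneous_induction (fun n w hw => ?_) (by simp)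
    fun v w hv hw => by simp [hv, hw]))
  by_cases h : n = 0
  · subst h
    rw [hA, Submodule.mem_span_singleton] at hw
    obtain ⟨b, rfl⟩ := hw
    simp [h1]
  -- Self-adjointness of L(0) makes the vacuum orthogonal to every V_n with n ≠ 0, so it would lie
  -- in the radical.
  · have h' := hB.L_adjoint 0 A.vac w
    rw [A.L_vac (by norm_num), map_zero, LinearMap.zero_apply, neg_zero, A.L_zero_of_mem hw,
      map_smul] at h'
    exact (smul_eq_zero.mp h'.symm).resolve_left (by simpa using h)

/-! ### The operators exp(x L(1)) and x^{L(0)} -/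

lemma expL1_eq_sum {v : V} {M : ℕ} (h : ∀ i ≥ M, (A.L 1 ^ i) v = 0) (x : ℂ) :
    A.expL1 x v = ∑ i ∈ Finset.range M, (x ^ i / (i.factorial : ℂ)) • (A.L 1 ^ i) v := by
  refine finsum_eq_sum_of_support_subset _ fun i hi => ?_
  by_contra hM
  exact hi (by simp [h i (by simpa using hM)])

lemma L_one_pow_eq_zero_of_le {v : V} {N : ℕ} (h : (A.L 1 ^ N) v = 0) (i : ℕ) (hi : N ≤ i) :
    (A.L 1 ^ i) v = 0 := by
  rw [← Nat.sub_add_cancel hi, pow_add, Module.End.mul_apply, h, map_zero]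

lemma exists_L_one_pow_eq_zero (v : V) : ∃ N : ℕ, (A.L 1 ^ N) v = 0 := by
  obtain ⟨N, hN⟩ := A.L_one_locally_nilpotent v
  exact ⟨N, hN N le_rfl⟩

@[simp]
lemma expL1_zero (v : V) : A.expL1 0 v = v := by
  obtain ⟨N, hN⟩ := A.exists_L_one_pow_eq_zero v
  rw [A.expL1_eq_sum (M := N + 1) fun i hi => A.L_one_pow_eq_zero_of_le hN i (by omega),
    Finset.sum_range_succ']
  simp

lemma expL1_apply_expL1 (x y : ℂ) (v : V) : A.expL1 x (A.expL1 y v) = A.expL1 (x + y) v := by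
  obtain ⟨N, hN⟩ := A.exists_L_one_pow_eq_zero v
  have hN := A.L_one_pow_eq_zero_of_le hN
  have hexp : ∀ i, (A.L 1 ^ i) (A.expL1 y v) =
      ∑ j ∈ Finset.range N, (y ^ j / (j.factorial : ℂ)) • (A.L 1 ^ (i + j)) v := by
    intro i
    rw [A.expL1_eq_sum hN, map_sum]
    simp only [map_smul, pow_add, Module.End.mul_apply]
  have hN' : ∀ i ≥ N, (A.L 1 ^ i) (A.expL1 y v) = 0 := fun i hi => by
    rw [hexp]
    exact Finset.sum_eq_zero fun j _ => by rw [hN _ (by omega), smul_zero]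
  rw [A.expL1_eq_sum hN (x + y), A.expL1_eq_sum hN']
  have hterm : ∀ m, ((x + y) ^ m / (m.factorial : ℂ)) • (A.L 1 ^ m) v =
      ∑ k ∈ Finset.range (m + 1), (x ^ k / (k.factorial : ℂ) * (y ^ (m - k) /
        ((m - k).factorial : ℂ))) • (A.L 1 ^ (k + (m - k))) v := by
    intro m
    rw [add_pow, Finset.sum_div, Finset.sum_smul]
    refine Finset.sum_congr rfl fun k hk => ?_
    have hk : k ≤ m := by simpa [Nat.lt_succ_iff] using hk
    rw [Nat.add_sub_cancel' hk, Nat.cast_choose ℂ hk]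
    congr 1
    field_simp [Nat.factorial_ne_zero]
  rw [Finset.sum_congr rfl fun m _ => hterm m, Finset.sum_range_diag_flip N fun k l =>
    (x ^ k / (k.factorial : ℂ) * (y ^ l / (l.factorial : ℂ))) • (A.L 1 ^ (k + l)) v]
  refine Finset.sum_congr rfl fun i _ => ?_
  rw [hexp, Finset.smul_sum]
  simp only [smul_smul]
  refine (Finset.sum_subset (Finset.range_mono (Nat.sub_le N i)) fun j _ hj => ?_).symm
  rw [hN _ (by simp at hj; omega), smul_zero]

lemma L_one_expL1 (x : ℂ) (v : V) : A.L 1 (A.expL1 x v) = A.expL1 x (A.L 1 v) := by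
  obtain ⟨N, hN⟩ := A.exists_L_one_pow_eq_zero v
  have hN := A.L_one_pow_eq_zero_of_le hN
  have hc : ∀ i, (A.L 1 ^ i) (A.L 1 v) = A.L 1 ((A.L 1 ^ i) v) := fun i => by
    rw [← Module.End.mul_apply, ← Module.End.mul_apply, pow_mul_comm']
  rw [A.expL1_eq_sum hN, A.expL1_eq_sum (M := N) fun i hi => by rw [hc, hN i hi, map_zero],
    map_sum]
  simp only [map_smul, hc]

lemma powL0_apply_of_degree {T : V →ₗ[ℂ] V} {d : ℤ} (hT : ∀ n, ∀ v ∈ A.gr n, T v ∈ A.gr (n + d))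
    {x : ℂ} (hx : x ≠ 0) (v : V) : A.powL0 x (T v) = x ^ d • T (A.powL0 x v) := by
  induction v using A.homogeneous_induction with
  | zero => simp
  | add v w hv hw => simp [hv, hw]
  | mem n v hv =>
    rw [A.powL0_of_mem x hv, A.powL0_of_mem x (hT n v hv), map_smul, smul_smul, add_comm,
      zpow_add₀ hx]

lemma powL0_expL1 (x : ℂ) {y : ℂ} (hy : y ≠ 0) (v : V) :
    A.powL0 y (A.expL1 x v) = A.expL1 (y⁻¹ * x) (A.powL0 y v) := by
  induction v using A.homogeneous_induction with
  | zero => simp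
  | add v w hv hw => simp [hv, hw]
  | mem n v hv =>
    obtain ⟨N, hN⟩ := A.exists_L_one_pow_eq_zero v
    have hN := A.L_one_pow_eq_zero_of_le hN
    rw [A.powL0_of_mem y hv, map_smul, A.expL1_eq_sum hN, A.expL1_eq_sum hN, map_sum,
      Finset.smul_sum]
    refine Finset.sum_congr rfl fun i _ => ?_
    rw [map_smul, A.powL0_of_mem y (A.L_one_pow_mem hv i), smul_smul, smul_smul, zpow_sub₀ hy,
      zpow_natCast, mul_pow, inv_pow]
    congr 1
    field_simp

lemma L_zero_L_one_pow (i : ℕ) (v : V) :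
    A.L 0 ((A.L 1 ^ i) v) = (A.L 1 ^ i) (A.L 0 v) - (i : ℂ) • (A.L 1 ^ i) v := by
  induction v using A.homogeneous_induction with
  | zero => simp
  | add v w hv hw => simp only [map_add, hv, hw, smul_add]; abel
  | mem n v hv =>
    rw [A.L_zero_of_mem hv, A.L_zero_of_mem (A.L_one_pow_mem hv i), map_smul]
    push_cast
    module

lemma L_neg_one_L_one_pow (i : ℕ) (v : V) :
    A.L (-1) ((A.L 1 ^ (i + 1)) v) = (A.L 1 ^ (i + 1)) (A.L (-1) v) +
      ((i + 1 : ℕ) : ℂ) • (A.L 1 ^ i) ((-2 : ℂ) • A.L 0 v) +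
      ((i + 1 : ℕ) * i : ℂ) • (A.L 1 ^ i) v := by
  induction i with
  | zero => simp [L_one_L_neg_one]
  | succ i ih =>
    have hc : ∀ j w, A.L 1 ((A.L 1 ^ j) w) = (A.L 1 ^ (j + 1)) w := fun j w => by
      rw [pow_succ', Module.End.mul_apply]
    have h : A.L (-1) ((A.L 1 ^ (i + 1 + 1)) v) =
        A.L 1 (A.L (-1) ((A.L 1 ^ (i + 1)) v)) - (2 : ℂ) • A.L 0 ((A.L 1 ^ (i + 1)) v) := by
      rw [L_one_L_neg_one, hc]
      abel
    rw [h, ih, L_zero_L_one_pow]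
    simp only [map_add, map_smul, hc]
    push_cast
    module

/-- This is exp(-x ad L(1)) applied to L(-1); the series stops after the quadratic term because (ad
L(1))³ kills L(-1). -/
lemma L_neg_one_expL1 (x : ℂ) (v : V) :
    A.L (-1) (A.expL1 x v) =
      A.expL1 x (A.L (-1) v - (2 * x) • A.L 0 v + x ^ 2 • A.L 1 v) := by
  obtain ⟨N₁, h₁⟩ := A.exists_L_one_pow_eq_zero v
  obtain ⟨N₂, h₂⟩ := A.exists_L_one_pow_eq_zero (A.L (-1) v)
  obtain ⟨N₃, h₃⟩ := A.exists_L_one_pow_eq_zero (A.L 0 v)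
  obtain ⟨M, hM₁, hM₂, hM₃⟩ : ∃ M, N₁ ≤ M ∧ N₂ ≤ M ∧ N₃ ≤ M := ⟨N₁ + N₂ + N₃, by omega⟩
  have h₁' := fun i (hi : i ≥ M) => A.L_one_pow_eq_zero_of_le h₁ i (by omega)
  have h₂' := fun i (hi : i ≥ M) => A.L_one_pow_eq_zero_of_le h₂ i (by omega)
  have h₃' := fun i (hi : i ≥ M) => A.L_one_pow_eq_zero_of_le h₃ i (by omega)
  have h₄' : ∀ i ≥ M, (A.L 1 ^ i) (A.L 1 v) = 0 := fun i hi => by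
    rw [← Module.End.mul_apply, ← pow_succ]
    exact h₁' _ (by omega)
  -- The cut-offs M + 2, M + 1 and M differ so that, after index shifts, all sums run over
  -- `Finset.range (M + 1)`.
  rw [map_add, map_sub, map_smul, map_smul,
    A.expL1_eq_sum (M := M + 2) (fun i hi => h₁' i (by omega)),
    A.expL1_eq_sum (M := M + 2) (fun i hi => h₂' i (by omega)),
    A.expL1_eq_sum (M := M + 1) (fun i hi => h₃' i (by omega)),
    A.expL1_eq_sum h₄', map_sum, Finset.sum_range_succ', Finset.sum_range_succ' _ (M + 1)]
  have e₄ : x ^ 2 • ∑ i ∈ Finset.range M, (x ^ i / (i.factorial : ℂ)) • (A.L 1 ^ i) (A.L 1 v) =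
      ∑ i ∈ Finset.range (M + 1), (x ^ (i + 1) / ((i + 1).factorial : ℂ)) •
        (((i + 1 : ℕ) * i : ℂ) • (A.L 1 ^ i) v) := by
    rw [Finset.sum_range_succ', Finset.smul_sum]
    simp only [Nat.cast_zero, mul_zero, zero_smul, smul_zero, add_zero]
    refine Finset.sum_congr rfl fun i _ => ?_
    rw [smul_smul, smul_smul, pow_succ _ i, Module.End.mul_apply]
    congr 1
    have h : (i : ℂ) + 1 + 1 ≠ 0 := by exact_mod_cast Nat.succ_ne_zero (i + 1)
    rw [Nat.factorial_succ, Nat.factorial_succ]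
    push_cast
    field_simp
    ring
  have e₃ : (2 * x) • ∑ i ∈ Finset.range (M + 1), (x ^ i / (i.factorial : ℂ)) •
      (A.L 1 ^ i) (A.L 0 v) = -∑ i ∈ Finset.range (M + 1), (x ^ (i + 1) / ((i + 1).factorial : ℂ)) •
        (((i + 1 : ℕ) : ℂ) • (A.L 1 ^ i) ((-2 : ℂ) • A.L 0 v)) := by
    rw [← Finset.sum_neg_distrib, Finset.smul_sum]
    refine Finset.sum_congr rfl fun i _ => ?_
    rw [map_smul, smul_smul, smul_smul, smul_smul, ← _root_.neg_smul]
    congr 1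
    rw [Nat.factorial_succ]
    push_cast
    field_simp
    ring
  rw [e₃, e₄]
  simp only [map_smul, L_neg_one_L_one_pow, smul_add, Finset.sum_add_distrib]
  simp only [pow_zero, Module.End.one_apply]
  abel

lemma hasDerivAt_expL1 (φ : Module.Dual ℂ V) (v : V) (x : ℂ) :
    HasDerivAt (fun x => φ (A.expL1 x v)) (φ (A.expL1 x (A.L 1 v))) x := by
  obtain ⟨N, hN⟩ := A.exists_L_one_pow_eq_zero v
  have hN := A.L_one_pow_eq_zero_of_le hN
  have h₁ : ∀ y, φ (A.expL1 y v) = φ v +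
      ∑ i ∈ Finset.range N, y ^ (i + 1) / ((i + 1).factorial : ℂ) * φ ((A.L 1 ^ (i + 1)) v) := by
    intro y
    rw [A.expL1_eq_sum (M := N + 1) fun i hi => hN i (by omega), Finset.sum_range_succ', map_add,
      map_sum, add_comm]
    simp
  have h₂ : φ (A.expL1 x (A.L 1 v)) =
      ∑ i ∈ Finset.range N, ((i + 1 : ℕ) * x ^ i) / ((i + 1).factorial : ℂ) *
        φ ((A.L 1 ^ (i + 1)) v) := by
    rw [A.expL1_eq_sum (M := N) fun i hi => by
      rw [← Module.End.mul_apply, ← pow_succ]; exact hN _ (by omega), map_sum]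
    refine Finset.sum_congr rfl fun i _ => ?_
    rw [map_smul, pow_succ, Module.End.mul_apply, smul_eq_mul, Nat.factorial_succ]
    congr 1
    push_cast
    field_simp
  simp only [h₁]
  rw [h₂]
  refine (HasDerivAt.fun_sum fun i _ => ?_).const_add _
  simpa using ((hasDerivAt_pow (i + 1) x).div_const _).mul_const _

/-! ### Bounded holomorphic functions and E₂ -/

/-- The algebra of holomorphic functions on the upper half plane that are bounded at `i∞`. -/
def bddHolo : Subalgebra ℂ (ℍ → ℂ) where
  carrier := {u | MDiff u ∧ IsBoundedAtImInfty u}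
  mul_mem' hu hv := ⟨hu.1.mul hv.1, hu.2.mul hv.2⟩
  add_mem' hu hv := ⟨hu.1.add hv.1, hu.2.add hv.2⟩
  algebraMap_mem' c := ⟨mdifferentiable_const, Filter.const_boundedAtFilter _ c⟩

lemma E2_mem_bddHolo : EisensteinSeries.E2 ∈ bddHolo :=
  ⟨E2_mdifferentiable, EisensteinSeries.isBoundedAtImInfty_E2⟩

lemma deriv_mem_bddHolo {u : ℍ → ℂ} (hu : u ∈ bddHolo) :
    (fun τ : ℍ => deriv (u ∘ ofComplex) τ) ∈ bddHolo := by
  have hd := UpperHalfPlane.mdifferentiable_iff.mp hu.1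
  have ho : IsOpen {z : ℂ | 0 < z.im} := isOpen_upperHalfPlaneSet
  refine ⟨?_, ?_⟩
  · rw [UpperHalfPlane.mdifferentiable_iff]
    refine (hd.deriv ho).congr fun z hz => ?_
    simp [ofComplex_apply_of_im_pos hz]
  · obtain ⟨M, B, h⟩ := isBoundedAtImInfty_iff.mp hu.2
    -- Cauchy's estimate on the unit disc about τ: the added margin keeps the disc in ℍ and above
    -- height B.
    refine isBoundedAtImInfty_iff.mpr ⟨M, max B 0 + 2, fun τ hτ => ?_⟩
    have him : ∀ z ∈ Metric.closedBall (τ : ℂ) 1, max B 0 < z.im := by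
      intro z hz
      have h1 := (Complex.abs_im_le_norm (z - τ)).trans (by simpa [dist_eq_norm] using hz)
      rw [Complex.sub_im, coe_im] at h1
      have := (abs_le.mp h1).1
      linarith
    have hpos : ∀ z ∈ Metric.closedBall (τ : ℂ) 1, 0 < z.im := fun z hz =>
      (le_max_right B 0).trans_lt (him z hz)
    simpa using Complex.norm_deriv_le_of_forall_mem_sphere_norm_le one_pos
      (DifferentiableOn.diffContOnCl_ball (hd.mono fun z hz => hpos z hz) subset_rfl)
      fun z hz => by
        have hz' := Metric.sphere_subset_closedBall hz
        rw [Function.comp_apply, ofComplex_apply_of_im_pos (hpos z hz')]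
        exact h _ ((le_max_left B 0).trans (him z hz').le)

lemma E2_smul (γ : SL(2, ℤ)) (τ : ℍ) :
    EisensteinSeries.E2 (γ • τ) = denom γ τ ^ 2 * EisensteinSeries.E2 τ +
      12 / (2 * Real.pi * Complex.I) * γ 1 0 * denom γ τ := by
  have h := congrFun (EisensteinSeries.E2_slash_action γ) τ
  rw [ModularForm.SL_slash_apply] at h
  simp only [Pi.sub_apply, Pi.smul_apply, smul_eq_mul, EisensteinSeries.D2, riemannZeta_two] at h
  have hj : denom γ τ ≠ 0 := denom_ne_zero γ τ
  have hπ : (Real.pi : ℂ) ≠ 0 := by exact_mod_cast Real.pi_ne_zero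
  have hI := Complex.I_sq
  rw [zpow_neg, ← div_eq_mul_inv, div_eq_iff (zpow_ne_zero _ hj)] at h
  rw [h]
  have e : (2 : ℤ) = ((2 : ℕ) : ℤ) := rfl
  rw [e, zpow_natCast]
  field_simp
  linear_combination (-12 * (γ 1 0 : ℂ)) * hI

/-! ### Reduction of F_N V-valued functions to scalar coordinates -/

instance (N : ℤ) : Module.Finite ℂ (A.F N) := by
  obtain ⟨n₀, hn₀⟩ := A.gr_bounded
  have := A.finite_gr
  have h : A.F N ≤ (Finset.Icc n₀ N).sup A.gr := by
    refine iSup_le fun n => ?_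
    by_cases hn : n.1 < n₀
    · rw [hn₀ _ hn]; exact bot_le
    · exact Finset.le_sup (f := A.gr) (Finset.mem_Icc.mpr ⟨not_lt.mp hn, n.2⟩)
  have := Submodule.finite_finset_sup (Finset.Icc n₀ N) A.gr
  exact Submodule.finiteDimensional_of_le h

lemma gr_le_F {n N : ℤ} (h : n ≤ N) : A.gr n ≤ A.F N :=
  le_iSup (fun m : {m : ℤ // m ≤ N} => A.gr m) ⟨n, h⟩

lemma apply_mem_F {T : V →ₗ[ℂ] V} {d N : ℤ} (hT : ∀ n, ∀ v ∈ A.gr n, T v ∈ A.gr (n + d)) {v : V}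
    (hv : v ∈ A.F N) : T v ∈ A.F (N + d) := by
  suffices A.F N ≤ (A.F (N + d)).comap T from this hv
  exact iSup_le fun n w hw => A.gr_le_F (by have := n.2; omega) (hT n w hw)

lemma expL1_mem_F {N : ℤ} (x : ℂ) {v : V} (hv : v ∈ A.F N) : A.expL1 x v ∈ A.F N := by
  suffices A.F N ≤ (A.F N).comap (A.expL1 x) from this hv
  refine iSup_le fun n w hw => ?_
  obtain ⟨M, hM⟩ := A.L_one_locally_nilpotent w
  rw [Submodule.mem_comap, A.expL1_eq_sum hM]
  exact Submodule.sum_mem _ fun i _ => Submodule.smul_mem _ _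
    (A.gr_le_F (by have := n.2; omega) (A.L_one_pow_mem hw i))

lemma exists_coordinates (N : ℤ) : ∃ (m : ℕ) (b : Fin m → V) (ψ : Fin m → Module.Dual ℂ V),
    (∀ i, b i ∈ A.F N) ∧ ∀ v ∈ A.F N, ∑ i, ψ i v • b i = v := by
  obtain ⟨p, hp⟩ := LinearMap.exists_leftInverse_of_injective (A.F N).subtype
    (Submodule.ker_subtype _)
  let B := Module.finBasis ℂ (A.F N)
  refine ⟨_, fun i => B i, fun i => B.coord i ∘ₗ p, fun i => (B i).2, fun v hv => ?_⟩
  have h : p v = ⟨v, hv⟩ := LinearMap.congr_fun hp ⟨v, hv⟩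
  have := congrArg (A.F N).subtype (B.sum_repr ⟨v, hv⟩)
  rw [map_sum] at this
  simpa only [LinearMap.comp_apply, h, Module.Basis.coord_apply, map_smul,
    Submodule.subtype_apply] using this

/-- Operators with coefficients in `bddHolo` preserve functions with coefficients in `bddHolo`. -/
lemma apply_mem_bddHolo {N : ℤ} {g : ℍ → V} (hN : ∀ τ, g τ ∈ A.F N)
    (hg : ∀ φ : Module.Dual ℂ V, (fun τ => φ (g τ)) ∈ bddHolo) {T : ℍ → V →ₗ[ℂ] V}
    (hT : ∀ (φ : Module.Dual ℂ V) (v : V), (fun τ => φ (T τ v)) ∈ bddHolo)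
    (φ : Module.Dual ℂ V) : (fun τ => φ (T τ (g τ))) ∈ bddHolo := by
  obtain ⟨m, b, ψ, -, h⟩ := A.exists_coordinates N
  have : (fun τ => φ (T τ (g τ))) =
      ∑ i, (fun τ => ψ i (g τ)) * (fun τ => φ (T τ (b i))) := by
    ext τ
    conv_lhs => rw [← h _ (hN τ)]
    simp
  rw [this]
  exact Subalgebra.sum_mem _ fun i _ => mul_mem (hg _) (hT _ _)

lemma const_mem_bddHolo (c : ℂ) : (fun _ => c) ∈ bddHolo := bddHolo.algebraMap_mem c

lemma expL1_mem_bddHolo {u : ℍ → ℂ} (hu : u ∈ bddHolo) (φ : Module.Dual ℂ V) (v : V) :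
    (fun τ => φ (A.expL1 (u τ) v)) ∈ bddHolo := by
  obtain ⟨M, hM⟩ := A.L_one_locally_nilpotent v
  have : (fun τ => φ (A.expL1 (u τ) v)) =
      ∑ i ∈ Finset.range M, (φ ((A.L 1 ^ i) v) / (i.factorial : ℂ)) • u ^ i := by
    ext τ
    rw [A.expL1_eq_sum hM]
    simp only [map_sum, map_smul, Finset.sum_apply, Pi.smul_apply, Pi.pow_apply, smul_eq_mul]
    exact Finset.sum_congr rfl fun i _ => by ring
  rw [this]
  exact Subalgebra.sum_mem _ fun i _ => Subalgebra.smul_mem _ (pow_mem hu i) _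

/-- For T the lower row is (0, 1). Forms are therefore 1-periodic, which is what a q-expansion
needs. -/
lemma K_T (τ : ℍ) (v : V) : A.K ModularGroup.T τ v = v := by
  have hj : denom ModularGroup.T τ = 1 := by
    rw [ModularGroup.denom_apply]
    simp [ModularGroup.T]
  have h : A.powL0 1 v = v := by
    induction v using A.homogeneous_induction with
    | zero => simp
    | add v w hv hw => simp [hv, hw]
    | mem n v hv => simp [A.powL0_of_mem 1 hv]
  rw [K, hj]
  simp [h, ModularGroup.T]

lemma periodic_comp_ofComplex {u : ℍ → ℂ} (hu : ∀ τ, u (ModularGroup.T • τ) = u τ) :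
    Function.Periodic (u ∘ ofComplex) (1 : ℝ) := by
  intro w
  by_cases! hw : 0 < w.im
  · have h : 0 < (w + (1 : ℝ)).im := by simpa using hw
    rw [Function.comp_apply, Function.comp_apply, ofComplex_apply_of_im_pos h,
      ofComplex_apply_of_im_pos hw, ← hu ⟨w, hw⟩]
    congr 1
    rw [modular_T_smul]
    ext
    simp [add_comm]
  · simp [ofComplex_apply_of_im_nonpos, hw]

/-- For functions satisfying the modular transformation law, the `q`-expansion may be replaced by
boundedness at `i∞`. -/
lemma IsModularForm.of_mem_bddHolo {A : VertexOperatorAlgebra V} {k N : ℤ} {f : ℍ → V}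
    (mem : ∀ τ, f τ ∈ A.F N) (coeff : ∀ φ : Module.Dual ℂ V, (fun τ => φ (f τ)) ∈ bddHolo)
    (modular : ∀ (γ : SL(2, ℤ)) (τ : ℍ), f (γ • τ) = denom γ τ ^ k • A.K γ τ (f τ)) :
    A.IsModularForm k N f where
  mem := mem
  holo φ := (coeff φ).1
  modular := modular
  qExp := by
    obtain ⟨m, b, ψ, hb, h⟩ := A.exists_coordinates N
    have hT : ∀ τ, f (ModularGroup.T • τ) = f τ := fun τ => by
      have hj : denom ModularGroup.T τ = 1 := by
        rw [ModularGroup.denom_apply]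
        simp [ModularGroup.T]
      rw [modular, K_T, hj]
      simp
    refine ⟨fun n => ∑ i, (qExpansion 1 fun τ => ψ i (f τ)).coeff n • b i,
      fun n => Submodule.sum_mem _ fun i _ => Submodule.smul_mem _ _ (hb i), fun φ τ => ?_⟩
    have hs : HasSum (fun n => ∑ i, ((qExpansion 1 fun τ => ψ i (f τ)).coeff n •
        Function.Periodic.qParam 1 τ ^ n) * φ (b i)) (∑ i, ψ i (f τ) * φ (b i)) :=
      hasSum_sum fun i _ => (hasSum_qExpansion one_pos
        (periodic_comp_ofComplex fun τ => by rw [hT]) (coeff (ψ i)).1 (coeff (ψ i)).2 τ).mul_right _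
    have e : φ (f τ) = ∑ i, ψ i (f τ) * φ (b i) := by
      conv_lhs => rw [← h _ (mem τ)]
      simp
    rw [e]
    convert! hs using 2 with n
    simp only [map_sum, map_smul, Finset.sum_mul, smul_eq_mul]
    refine Finset.sum_congr rfl fun i _ => ?_
    simp [Function.Periodic.qParam]
    ring

lemma IsModularForm.coeff_mem_bddHolo {A : VertexOperatorAlgebra V} {k N : ℤ} {f : ℍ → V}
    (hf : A.IsModularForm k N f) (φ : Module.Dual ℂ V) : (fun τ => φ (f τ)) ∈ bddHolo := by
  obtain ⟨a, -, ha⟩ := hf.qExp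
  refine ⟨hf.holo φ, isBoundedAtImInfty_of_hasSum_qExpansion (h := 1) one_pos
    (c := fun n => φ (a n)) fun τ => ?_⟩
  simpa [Function.Periodic.qParam] using ha φ τ

/-! ### Untwisting by E₂ -/

/-- The quasimodular function `-(2πi / 12) E₂`, whose defect of modularity matches the cocycle
`K`. -/
def twist (τ : ℍ) : ℂ := -(2 * Real.pi * Complex.I / 12) * EisensteinSeries.E2 τ

lemma twist_mem_bddHolo : twist ∈ bddHolo :=
  mul_mem (const_mem_bddHolo _) E2_mem_bddHolo

lemma twist_smul (γ : SL(2, ℤ)) (τ : ℍ) :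
    twist (γ • τ) = denom γ τ ^ 2 * twist τ - γ 1 0 * denom γ τ := by
  have hπ : (Real.pi : ℂ) ≠ 0 := by exact_mod_cast Real.pi_ne_zero
  rw [twist, E2_smul, twist]
  field_simp [Complex.I_ne_zero]
  ring

/-- The functions `g` with `g(γτ) = j(γ, τ)^k j(γ, τ)^{-2 L(0)} g(τ)`: the component of `g` in `V_n`
is a modular form of weight `k - 2n`. -/
structure IsGradedForm (k N : ℤ) (g : ℍ → V) : Prop where
  mem : ∀ τ, g τ ∈ A.F N
  coeff : ∀ φ : Module.Dual ℂ V, (fun τ => φ (g τ)) ∈ bddHolo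
  modular : ∀ (γ : SL(2, ℤ)) (τ : ℍ),
    g (γ • τ) = denom γ τ ^ k • A.powL0 (denom γ τ ^ (-2 : ℤ)) (g τ)

variable {A}

lemma denom_zpow_ne_zero (γ : SL(2, ℤ)) (τ : ℍ) (n : ℤ) : denom γ τ ^ n ≠ 0 :=
  zpow_ne_zero _ (denom_ne_zero γ τ)

/-- Moving j^{-2L(0)} past exp(φ L(1)) multiplies the exponent by j², and φ(γτ) = j²φ(τ) - cj; the
remaining factor exp(-cj L(1)) is the one in `K`. -/
lemma IsGradedForm.twist {k N : ℤ} {g : ℍ → V} (hg : A.IsGradedForm k N g) :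
    A.IsModularForm k N fun τ => A.expL1 (twist τ) (g τ) := by
  refine .of_mem_bddHolo (fun τ => A.expL1_mem_F _ (hg.mem τ))
    (fun φ => A.apply_mem_bddHolo hg.mem hg.coeff (A.expL1_mem_bddHolo twist_mem_bddHolo) φ)
    fun γ τ => ?_
  rw [hg.modular, map_smul, K, Module.End.mul_apply,
    A.powL0_expL1 _ (denom_zpow_ne_zero γ τ (-2)), expL1_apply_expL1, twist_smul]
  congr 3
  rw [zpow_neg, inv_inv, zpow_ofNat]
  ring

lemma IsModularForm.untwist {k N : ℤ} {f : ℍ → V} (hf : A.IsModularForm k N f) :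
    A.IsGradedForm k N fun τ => A.expL1 (-VertexOperatorAlgebra.twist τ) (f τ) where
  mem τ := A.expL1_mem_F _ (hf.mem τ)
  coeff φ := A.apply_mem_bddHolo hf.mem hf.coeff_mem_bddHolo
    (A.expL1_mem_bddHolo (neg_mem twist_mem_bddHolo)) φ
  modular γ τ := by
    rw [hf.modular, map_smul, K, Module.End.mul_apply,
      A.powL0_expL1 _ (denom_zpow_ne_zero γ τ (-2)), expL1_apply_expL1, twist_smul]
    congr 3
    rw [zpow_neg, inv_inv, zpow_ofNat]
    ring

/-- The V_n-component, of weight k - 2n, moves to V_{n+d}, where k - 2n = (k + 2d) - 2(n + d). -/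
lemma IsGradedForm.apply {k N d : ℤ} {g : ℍ → V} (hg : A.IsGradedForm k N g) {T : V →ₗ[ℂ] V}
    (hT : ∀ n, ∀ v ∈ A.gr n, T v ∈ A.gr (n + d)) :
    A.IsGradedForm (k + 2 * d) (N + d) fun τ => T (g τ) where
  mem τ := A.apply_mem_F hT (hg.mem τ)
  coeff φ := hg.coeff (φ ∘ₗ T)
  modular γ τ := by
    rw [hg.modular, map_smul, A.powL0_apply_of_degree hT (denom_zpow_ne_zero γ τ (-2)), smul_smul,
      ← zpow_mul, ← zpow_add₀ (denom_ne_zero γ τ)]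
    congr 2
    ring

/-! ### Scalar components and finite-dimensionality -/

/-- The functions underlying the modular forms of level one and weight `w`. -/
def scalarFunctions (w : ℤ) : Submodule ℂ (ℍ → ℂ) where
  carrier := {u | u ∈ bddHolo ∧ ∀ (γ : SL(2, ℤ)) (τ : ℍ), u (γ • τ) = denom γ τ ^ w * u τ}
  zero_mem' := ⟨zero_mem _, by simp⟩
  add_mem' := by
    rintro u v ⟨hu, hu'⟩ ⟨hv, hv'⟩
    exact ⟨add_mem hu hv, fun γ τ => by
      rw [Pi.add_apply, Pi.add_apply, hu', hv', mul_add]⟩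
  smul_mem' := by
    rintro c u ⟨hu, hu'⟩
    exact ⟨Subalgebra.smul_mem _ hu c, fun γ τ => by
      rw [Pi.smul_apply, Pi.smul_apply, hu', smul_eq_mul, smul_eq_mul, mul_left_comm]⟩

/-- The modular form with underlying function `u`. -/
def toModularForm (w : ℤ) : scalarFunctions w →ₗ[ℂ] ModularForm 𝒮ℒ w where
  toFun u :=
    have h (γ : SL(2, ℤ)) : SlashAction.map w γ (u : ℍ → ℂ) = u := by
      ext τ
      rw [ModularForm.SL_slash_apply, u.2.2, mul_right_comm, ← zpow_add₀ (denom_ne_zero γ τ)]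
      simp
    { toFun := u
      slash_action_eq' := by
        rintro _ ⟨γ, rfl⟩
        exact h γ
      holo' := u.2.1.1
      bdd_at_cusps' := fun hc => (OnePoint.isBoundedAt_iff_forall_SL2Z hc).mpr fun γ _ => by
        rw [h]
        exact u.2.1.2 }
  map_add' _ _ := rfl
  map_smul' _ _ := rfl

@[simp]
lemma toModularForm_apply {w : ℤ} (u : scalarFunctions w) (τ : ℍ) :
    toModularForm w u τ = (u : ℍ → ℂ) τ := rfl

lemma toModularForm_injective (w : ℤ) : Function.Injective (toModularForm w) := fun _ _ h =>
  Subtype.ext <| funext fun τ => DFunLike.congr_fun h τ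

instance (w : ℤ) : Module.Finite ℂ (scalarFunctions w) :=
  FiniteDimensional.of_injective (toModularForm w) (toModularForm_injective w)

lemma scalarFunctions_eq_zero {w : ℤ} (hw : w < 0) {u : ℍ → ℂ} (hu : u ∈ scalarFunctions w) :
    u = 0 :=
  ModularFormClass.levelOne_neg_weight_eq_zero hw (toModularForm w ⟨u, hu⟩)

variable (A)

/-- A linear functional which is homogeneous of degree `n`. -/
def IsHomogeneousFunctional (n : ℤ) (ψ : Module.Dual ℂ V) : Prop :=
  ∀ m, m ≠ n → ∀ v ∈ A.gr m, ψ v = 0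

/-- The projection onto `V_n`. -/
def proj (n : ℤ) : V →ₗ[ℂ] A.gr n :=
  DirectSum.component ℂ ℤ (fun n => A.gr n) n ∘ₗ A.decomp.toLinearMap

lemma proj_of_mem {n : ℤ} {v : V} (hv : v ∈ A.gr n) : A.proj n v = ⟨v, hv⟩ := by
  rw [proj, LinearMap.comp_apply, LinearEquiv.coe_coe, A.decomp_of_mem hv]
  exact DirectSum.component.lof_self (R := ℂ) _ _

lemma proj_of_mem_ne {m n : ℤ} (h : m ≠ n) {v : V} (hv : v ∈ A.gr m) : A.proj n v = 0 := by
  rw [proj, LinearMap.comp_apply, LinearEquiv.coe_coe, A.decomp_of_mem hv]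
  exact DirectSum.of_eq_of_ne (β := fun n => A.gr n) _ _ _ h.symm

lemma eq_zero_of_proj {v : V} (h : ∀ n, A.proj n v = 0) : v = 0 :=
  A.decomp.map_eq_zero_iff.mp (DFinsupp.ext h)

lemma isHomogeneousFunctional_comp_proj (n : ℤ) (φ : Module.Dual ℂ (A.gr n)) :
    A.IsHomogeneousFunctional n (φ ∘ₗ A.proj n) := fun m hm v hv => by
  rw [LinearMap.comp_apply, A.proj_of_mem_ne hm hv, map_zero]

variable {A}

lemma IsHomogeneousFunctional.powL0 {n : ℤ} {ψ : Module.Dual ℂ V}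
    (hψ : A.IsHomogeneousFunctional n ψ) (x : ℂ) (v : V) : ψ (A.powL0 x v) = x ^ n * ψ v := by
  induction v using A.homogeneous_induction with
  | zero => simp
  | add v w hv hw => simp [hv, hw, mul_add]
  | mem m v hv =>
    rw [A.powL0_of_mem x hv, map_smul, smul_eq_mul]
    by_cases h : m = n
    · rw [h]
    · rw [hψ m h v hv, mul_zero, mul_zero]

lemma IsGradedForm.comp_mem {k N n : ℤ} {g : ℍ → V} (hg : A.IsGradedForm k N g)
    {ψ : Module.Dual ℂ V} (hψ : A.IsHomogeneousFunctional n ψ) :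
    (fun τ => ψ (g τ)) ∈ scalarFunctions (k - 2 * n) := by
  refine ⟨hg.coeff ψ, fun γ τ => ?_⟩
  change ψ (g (γ • τ)) = _ * ψ (g τ)
  rw [hg.modular, map_smul, hψ.powL0, smul_eq_mul, ← mul_assoc, ← zpow_mul,
    ← zpow_add₀ (denom_ne_zero γ τ)]
  congr 2
  ring

variable (A)

/-- The coefficient functions of `exp(-φ L(1)) f`, with `φ = -(2πi / 12) E₂`. -/
def coeffMap (k : ℤ) (ψ : Module.Dual ℂ V) : A.modForms k →ₗ[ℂ] (ℍ → ℂ) where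
  toFun f τ := ψ (A.expL1 (-twist τ) ((f : ℍ → V) τ))
  map_add' f g := by ext τ; simp
  map_smul' c f := by ext τ; simp

lemma coeffMap_mem {k n : ℤ} {ψ : Module.Dual ℂ V} (hψ : A.IsHomogeneousFunctional n ψ)
    (f : A.modForms k) : A.coeffMap k ψ f ∈ scalarFunctions (k - 2 * n) := by
  obtain ⟨N, hf⟩ := f.2
  exact hf.untwist.comp_mem hψ

/-- The coordinates of the untwisted form embed M_k(V) into a finite product of spaces of scalar
forms. Components with n < 0 vanish by `gr_neg`, those with n > k/2 because their weight is
negative. -/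
lemma finite_modForms (hA : A.IsCFTType) (k : ℤ) : Module.Finite ℂ (A.modForms k) := by
  have := A.finite_gr
  let b := fun n => Module.finBasis ℂ (A.gr n)
  let Φ : A.modForms k →ₗ[ℂ] (n : Finset.Icc 0 (k / 2)) → (i : Fin (Module.finrank ℂ (A.gr n))) →
      scalarFunctions (k - 2 * n) :=
    LinearMap.pi fun n => LinearMap.pi fun i =>
      (A.coeffMap k ((b n).coord i ∘ₗ A.proj n)).codRestrict _
        (A.coeffMap_mem (A.isHomogeneousFunctional_comp_proj _ _))
  refine FiniteDimensional.of_injective Φ ?_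
  rw [← LinearMap.ker_eq_bot, LinearMap.ker_eq_bot']
  intro f hf
  refine Subtype.ext <| funext fun τ => ?_
  suffices A.expL1 (-twist τ) ((f : ℍ → V) τ) = 0 by
    have h := A.expL1_apply_expL1 (twist τ) (-twist τ) ((f : ℍ → V) τ)
    rw [this, map_zero, add_neg_cancel, expL1_zero] at h
    exact h.symm
  refine A.eq_zero_of_proj fun n => ?_
  refine (b n).forall_coord_eq_zero_iff.mp fun i => ?_
  by_cases hn : n ∈ Finset.Icc 0 (k / 2)
  · exact congrFun (congrArg Subtype.val (congrFun (congrFun hf ⟨n, hn⟩) i)) τ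
  · rw [Finset.mem_Icc, not_and_or, not_le, not_le] at hn
    rcases hn with hn | hn
    · have : A.proj n (A.expL1 (-twist τ) ((f : ℍ → V) τ)) = 0 := by
        have h := (A.proj n (A.expL1 (-twist τ) ((f : ℍ → V) τ))).2
        exact Subtype.ext ((A.gr_neg hA hn).le h)
      rw [this, map_zero]
    · exact congrFun (scalarFunctions_eq_zero (by omega)
        (A.coeffMap_mem (A.isHomogeneousFunctional_comp_proj n ((b n).coord i)) f)) τ

/-! ### The vacuum coefficient, and the kernel and image of L(1) on forms -/

lemma expL1_vac (x : ℂ) : A.expL1 x A.vac = A.vac := by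
  rw [A.expL1_eq_sum (M := 1) (A.L_one_pow_eq_zero_of_le (by simpa using A.L_vac (by norm_num)))]
  simp

/-- The coefficient of the vacuum, as a linear functional. -/
lemma exists_vacFunctional (hA : A.IsCFTType) : ∃ ψ : Module.Dual ℂ V,
    A.IsHomogeneousFunctional 0 ψ ∧ ψ A.vac = 1 ∧ ∀ v ∈ A.gr 0, ψ v • A.vac = v := by
  obtain ⟨φ, hφ⟩ : ∃ φ : Module.Dual ℂ (A.gr 0), φ ⟨A.vac, A.vac_mem⟩ ≠ 0 := by
    by_contra! h
    exact A.vac_ne_zero (congrArg Subtype.val ((Module.forall_dual_apply_eq_zero_iff ℂ _).mp h))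
  have h1 : (φ ⟨A.vac, A.vac_mem⟩)⁻¹ • φ (A.proj 0 A.vac) = 1 := by
    rw [A.proj_of_mem A.vac_mem, smul_eq_mul, inv_mul_cancel₀ hφ]
  refine ⟨((φ ⟨A.vac, A.vac_mem⟩)⁻¹ • φ) ∘ₗ A.proj 0, A.isHomogeneousFunctional_comp_proj _ _, h1,
    fun v hv => ?_⟩
  rw [hA, Submodule.mem_span_singleton] at hv
  obtain ⟨a, rfl⟩ := hv
  simp only [LinearMap.comp_apply, LinearMap.smul_apply, map_smul]
  rw [h1, smul_eq_mul, mul_one]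

/-- The vacuum coefficient of the untwisted form has weight k and retracts M_k(V) onto M_k, because
exp(x L(1)) fixes the vacuum. -/
lemma isCompl_scalarForms {ψ : Module.Dual ℂ V} (h : A.IsHomogeneousFunctional 0 ψ)
    (h1 : ψ A.vac = 1) (k : ℤ) : IsCompl (A.scalarForms k) (LinearMap.ker (A.coeffMap k ψ)) := by
  have hvac : ∀ F : ModularForm 𝒮ℒ k, A.coeffMap k ψ (A.vacForm k F) = F := fun F => by
    ext τ
    change ψ (A.expL1 (-twist τ) (F τ • A.vac)) = F τ
    rw [map_smul, expL1_vac, map_smul, h1, smul_eq_mul, mul_one]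
  refine ⟨?_, ?_⟩
  · rw [Submodule.disjoint_def]
    rintro _ ⟨F, rfl⟩ hF
    rw [LinearMap.mem_ker, hvac] at hF
    rw [show F = 0 from DFunLike.coe_injective hF, map_zero]
  · rw [codisjoint_iff, eq_top_iff]
    rintro f -
    have hf := A.coeffMap_mem h f
    rw [mul_zero, sub_zero] at hf
    rw [← add_sub_cancel (A.vacForm k (toModularForm k ⟨_, hf⟩)) f]
    refine Submodule.add_mem_sup ⟨_, rfl⟩ ?_
    rw [LinearMap.mem_ker, map_sub, hvac]
    ext τ
    simp

/-- The action of `L(1)` on vector-valued modular forms. -/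
def lowering (k : ℤ) : A.modForms k →ₗ[ℂ] A.modForms (k - 2) where
  toFun f := ⟨fun τ => A.L 1 ((f : ℍ → V) τ), by
    obtain ⟨N, hf⟩ := f.2
    -- Untwist, apply L(1), twist back: L(1) commutes with the exponentials, which then cancel.
    have h := (hf.untwist.apply (T := A.L 1) (d := -1) fun n v hv => A.L_mem 1 hv).twist
    simp only [← L_one_expL1, expL1_apply_expL1, add_neg_cancel, expL1_zero] at h
    exact ⟨_, h⟩⟩
  map_add' f g := by ext τ; simp
  map_smul' c f := by ext τ; simp

lemma ker_lowering (k : ℤ) : LinearMap.ker (A.lowering k) = A.quasiPrimaryForms k := by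
  ext f
  rw [LinearMap.mem_ker]
  exact ⟨fun h τ => congrFun (congrArg Subtype.val h) τ, fun h => Subtype.ext (funext h)⟩

/-- The lift is obtained by applying a degree-one section s of L(1) to the untwisted form and
twisting back. -/
lemma exists_lowering_eq {k : ℤ} (h : A.modForms (k - 2)) {s : V →ₗ[ℂ] V}
    (hs : ∀ n, ∀ v ∈ A.gr n, s v ∈ A.gr (n + 1))
    (hh : ∀ τ, A.L 1 (s (A.expL1 (-twist τ) ((h : ℍ → V) τ))) =
      A.expL1 (-twist τ) ((h : ℍ → V) τ)) : ∃ f, A.lowering k f = h := by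
  obtain ⟨N, hN⟩ := h.2
  have hf := (hN.untwist.apply hs).twist
  rw [show k - 2 + 2 * 1 = k by ring] at hf
  refine ⟨⟨_, _, hf⟩, Subtype.ext <| funext fun τ => ?_⟩
  change A.L 1 (A.expL1 (twist τ) (s (A.expL1 (-twist τ) ((h : ℍ → V) τ)))) = _
  rw [L_one_expL1, hh, expL1_apply_expL1, add_neg_cancel, expL1_zero]

/-- If `L(1)` does not vanish on `V_1` then every form is in the image of `L(1)`. -/
lemma range_lowering_eq_top (hA : A.IsCFTType) (k : ℤ) (h1 : ∃ v ∈ A.gr 1, A.L 1 v ≠ 0) :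
    LinearMap.range (A.lowering k) = ⊤ := by
  obtain ⟨s, hs, hs'⟩ := A.exists_section_L_one
  refine LinearMap.range_eq_top.mpr fun h => A.exists_lowering_eq h hs fun τ => ?_
  generalize A.expL1 (-twist τ) ((h : ℍ → V) τ) = v
  induction v using A.homogeneous_induction with
  | zero => simp
  | add v w hv hw => simp [hv, hw]
  | mem n v hv =>
    refine hs' n (fun v hv => ?_) v hv
    rcases lt_trichotomy n 0 with hn | rfl | hn
    · rw [A.gr_neg hA hn, Submodule.mem_bot] at hv
      exact ⟨0, zero_mem _, by simp [hv]⟩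
    · obtain ⟨u, hu, hu0⟩ := h1
      have hu1 : A.L 1 u ∈ A.gr 0 := by simpa using A.L_mem 1 hu
      rw [hA, Submodule.mem_span_singleton] at hu1 hv
      obtain ⟨a, ha⟩ := hu1
      obtain ⟨b, rfl⟩ := hv
      have ha0 : a ≠ 0 := by rintro rfl; exact hu0 (by simpa using ha.symm)
      exact ⟨(b * a⁻¹) • u, Submodule.smul_mem _ _ (by simpa using hu), by
        rw [map_smul, ← ha, smul_smul, inv_mul_cancel_right₀ ha0]⟩
    · exact A.exists_L_one_eq hA hn hv

/-- If `L(1)` vanishes on `V_1` then the image of `L(1)` consists of the forms without vacuum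
coefficient. -/
lemma range_lowering_eq_ker (hA : A.IsCFTType) (k : ℤ) (h1 : ∀ v ∈ A.gr 1, A.L 1 v = 0)
    {ψ : Module.Dual ℂ V} (h : A.IsHomogeneousFunctional 0 ψ)
    (hψ : ∀ v ∈ A.gr 0, ψ v • A.vac = v) :
    LinearMap.range (A.lowering k) = LinearMap.ker (A.coeffMap (k - 2) ψ) := by
  have hL : ∀ v, ψ (A.L 1 v) = 0 := fun v => by
    induction v using A.homogeneous_induction with
    | zero => simp
    | add v w hv hw => simp [hv, hw]
    | mem n v hv =>
      by_cases hn : n = 1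
      · subst hn
        rw [h1 v hv, map_zero]
      · exact h (n - 1) (by omega) _ (A.L_mem 1 hv)
  apply le_antisymm
  · rintro _ ⟨f, rfl⟩
    rw [LinearMap.mem_ker]
    ext τ
    change ψ (A.expL1 (-twist τ) (A.L 1 ((f : ℍ → V) τ))) = 0
    rw [← L_one_expL1, hL]
  · intro f hf
    obtain ⟨s, hs, hs'⟩ := A.exists_section_L_one
    refine A.exists_lowering_eq f hs fun τ => ?_
    have hv : ψ (A.expL1 (-twist τ) ((f : ℍ → V) τ)) = 0 := congrFun hf τ
    generalize A.expL1 (-twist τ) ((f : ℍ → V) τ) = v at hv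
    -- On V_0 the vector s v lies in V_1 and is killed by L(1); in positive weight L(1)s is the
    -- identity.
    suffices A.L 1 (s v) = v - ψ v • A.vac by rw [this, hv]; simp
    clear hv
    induction v using A.homogeneous_induction with
    | zero => simp
    | add v w hv hw => simp only [map_add, hv, hw]; module
    | mem n v hv =>
      rcases lt_trichotomy n 0 with hn | rfl | hn
      · rw [A.gr_neg hA hn, Submodule.mem_bot] at hv
        simp [hv]
      · rw [hψ v hv, sub_self]
        exact h1 _ (by simpa using hs 0 v hv)
      · rw [h n hn.ne' v hv, zero_smul, sub_zero]
        exact hs' n (fun v hv => A.exists_L_one_eq hA hn hv) v hv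

/-! ### The modular derivative -/

lemma vDeriv_eq {f : ℍ → V} {τ : ℍ} {w : V} (h : ∀ φ : Module.Dual ℂ V,
    HasDerivAt (fun z : ℂ => φ (f (ofComplex z))) (φ w) τ) : vDeriv f τ = w := by
  have h' := Classical.epsilon_spec (p := fun w => ∀ φ : Module.Dual ℂ V,
    HasDerivAt (fun z : ℂ => φ (f (ofComplex z))) (φ w) τ) ⟨w, h⟩
  rw [← sub_eq_zero, ← Module.forall_dual_apply_eq_zero_iff ℂ]
  intro φ
  rw [map_sub, sub_eq_zero]
  exact (h' φ).unique (h φ)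

variable {A} in
lemma IsModularForm.exists_hasDerivAt {k N : ℤ} {f : ℍ → V} (hf : A.IsModularForm k N f) (τ : ℍ) :
    ∃ w ∈ A.F N, ∀ φ : Module.Dual ℂ V, HasDerivAt (fun z : ℂ => φ (f (ofComplex z))) (φ w) τ := by
  obtain ⟨m, b, ψ, hb, h⟩ := A.exists_coordinates N
  refine ⟨∑ i, deriv (fun z : ℂ => ψ i (f (ofComplex z))) τ • b i,
    Submodule.sum_mem _ fun i _ => Submodule.smul_mem _ _ (hb i), fun φ => ?_⟩
  have e : (fun z : ℂ => φ (f (ofComplex z))) =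
      fun z : ℂ => ∑ i, ψ i (f (ofComplex z)) * φ (b i) := by
    ext z
    conv_lhs => rw [← h _ (hf.mem (ofComplex z))]
    simp
  rw [e, map_sum]
  simp only [map_smul, smul_eq_mul]
  exact HasDerivAt.fun_sum fun i _ => HasDerivAt.mul_const
    (UpperHalfPlane.mdifferentiableAt_iff.mp (hf.holo (ψ i) τ)).hasDerivAt _

variable {A} in
lemma IsModularForm.hasDerivAt {k N : ℤ} {f : ℍ → V} (hf : A.IsModularForm k N f) (τ : ℍ)
    (φ : Module.Dual ℂ V) :
    HasDerivAt (fun z : ℂ => φ (f (ofComplex z))) (φ (vDeriv f τ)) τ := by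
  obtain ⟨w, -, hw⟩ := hf.exists_hasDerivAt τ
  rw [vDeriv_eq hw]
  exact hw φ

variable {A} in
lemma IsModularForm.vDeriv_mem {k N : ℤ} {f : ℍ → V} (hf : A.IsModularForm k N f) (τ : ℍ) :
    vDeriv f τ ∈ A.F N := by
  obtain ⟨w, hw, hw'⟩ := hf.exists_hasDerivAt τ
  rwa [vDeriv_eq hw']

lemma hasDerivAt_denom (γ : SL(2, ℤ)) (τ : ℍ) :
    HasDerivAt (fun z : ℂ => denom γ (ofComplex z)) (γ 1 0 : ℂ) τ := by
  have h : HasDerivAt (fun z : ℂ => (γ 1 0 : ℂ) * z + γ 1 1) (γ 1 0 : ℂ) τ := by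
    simpa using ((hasDerivAt_id (τ : ℂ)).const_mul (γ 1 0 : ℂ)).add_const (γ 1 1 : ℂ)
  refine h.congr_of_eventuallyEq ?_
  filter_upwards [isOpen_upperHalfPlaneSet.mem_nhds τ.im_pos] with z hz
  rw [ModularGroup.denom_apply, ofComplex_apply_of_im_pos hz]

/-- The derivative of the cocycle `K(γ, τ)` with respect to `τ`. -/
def KDeriv (γ : SL(2, ℤ)) (τ : ℍ) : Module.End ℂ V :=
  A.expL1 (-(γ 1 0 : ℂ) * denom γ τ) *
    ((-(γ 1 0 : ℂ) ^ 2) • A.L 1 - (2 * γ 1 0 * (denom γ τ)⁻¹ : ℂ) • A.L 0) *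
    A.powL0 (denom γ τ ^ (-2 : ℤ))

lemma hasDerivAt_K (γ : SL(2, ℤ)) (τ : ℍ) (φ : Module.Dual ℂ V) (v : V) :
    HasDerivAt (fun z : ℂ => φ (A.K γ (ofComplex z) v)) (φ (A.KDeriv γ τ v)) τ := by
  induction v using A.homogeneous_induction with
  | zero => simpa using hasDerivAt_const (τ : ℂ) (0 : ℂ)
  | add v w hv hw => simpa using hv.fun_add hw
  | mem n v hv =>
    have hj := hasDerivAt_denom γ τ
    have h0 : denom γ (ofComplex τ) ≠ 0 := denom_ne_zero γ _
    have h1 := (hasDerivAt_zpow (-2 * n) _ (Or.inl h0)).comp (τ : ℂ) hj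
    have h2 := (A.hasDerivAt_expL1 φ v _).comp (τ : ℂ) (hj.const_mul (-(γ 1 0 : ℂ)))
    have h3 := h1.mul h2
    simp only [Function.comp_def, ofComplex_apply] at h3 h0
    convert! h3 using 1
    · ext z
      rw [K, Module.End.mul_apply, A.powL0_of_mem _ hv, map_smul, map_smul, smul_eq_mul, ← zpow_mul]
      rfl
    · rw [KDeriv, Module.End.mul_apply, Module.End.mul_apply, A.powL0_of_mem _ hv, map_smul,
        LinearMap.sub_apply, LinearMap.smul_apply, LinearMap.smul_apply, A.L_zero_of_mem hv,
        ← zpow_mul, zpow_sub_one₀ h0]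
      simp only [map_smul, map_sub, smul_eq_mul]
      push_cast
      ring

variable {A} in
-- The transformation law is differentiated on both sides, with d(γτ)/dτ = j^{-2} and dj/dτ = c.
lemma IsModularForm.vDeriv_smul {k N : ℤ} {f : ℍ → V} (hf : A.IsModularForm k N f)
    (γ : SL(2, ℤ)) (τ : ℍ) :
    vDeriv f (γ • τ) = denom γ τ ^ (k + 2) • (((k : ℂ) * γ 1 0 * (denom γ τ)⁻¹) • A.K γ τ (f τ) +
      A.KDeriv γ τ (f τ) + A.K γ τ (vDeriv f τ)) := by
  obtain ⟨m, b, ψ, hb, h⟩ := A.exists_coordinates N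
  have hj := hasDerivAt_denom γ τ
  have h0 : denom γ (ofComplex τ) ≠ 0 := denom_ne_zero γ _
  rw [← sub_eq_zero, ← Module.forall_dual_apply_eq_zero_iff ℂ]
  intro φ
  rw [map_sub, sub_eq_zero]
  have hdet : (γ : GL (Fin 2) ℝ).val.det = 1 := by
    rw [← Matrix.GeneralLinearGroup.val_det_apply]; simp
  have hs := (hasStrictDerivAt_smul (g := (γ : GL (Fin 2) ℝ)) (by rw [hdet]; exact one_pos)
    τ).hasDerivAt
  rw [hdet] at hs
  have hl : HasDerivAt (fun z : ℂ => φ (f (γ • ofComplex z)))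
      (φ (vDeriv f (γ • τ)) * (1 / denom γ τ ^ 2)) τ := by
    have h1 : HasDerivAt (fun z : ℂ => φ (f (ofComplex z))) (φ (vDeriv f (γ • τ)))
        ((γ • ofComplex (τ : ℂ) : ℍ) : ℂ) := by
      rw [ofComplex_apply]
      exact hf.hasDerivAt (γ • τ) φ
    have := h1.comp (τ : ℂ) hs
    simpa [Function.comp_def] using this
  have hK : HasDerivAt (fun z : ℂ => φ (A.K γ (ofComplex z) (f (ofComplex z))))
      (φ (A.KDeriv γ τ (f τ)) + φ (A.K γ τ (vDeriv f τ))) τ := by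
    have e (T : ℍ → Module.End ℂ V) (τ τ' : ℍ) (w : V) (hw : w ∈ A.F N) :
        φ (T τ w) = ∑ i, ψ i w * φ (T τ (b i)) := by
      conv_lhs => rw [← h w hw]
      simp
    have e' : (fun z : ℂ => φ (A.K γ (ofComplex z) (f (ofComplex z)))) =
        fun z : ℂ => ∑ i, ψ i (f (ofComplex z)) * φ (A.K γ (ofComplex z) (b i)) :=
      funext fun z => e (A.K γ) _ τ _ (hf.mem _)
    rw [e', e (A.KDeriv γ) _ τ _ (hf.mem _), e (A.K γ) _ τ _ (hf.vDeriv_mem _),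
      ← Finset.sum_add_distrib]
    refine HasDerivAt.fun_sum fun i _ => ?_
    have := (hf.hasDerivAt τ (ψ i)).mul (A.hasDerivAt_K γ τ φ (b i))
    rw [ofComplex_apply, add_comm] at this
    exact this
  have hr := ((hasDerivAt_zpow k _ (Or.inl h0)).comp (τ : ℂ) hj).mul hK
  have e : (fun z : ℂ => φ (f (γ • ofComplex z))) =
      ((fun x => x ^ k) ∘ fun z : ℂ => denom γ (ofComplex z)) *
      fun z : ℂ => φ (A.K γ (ofComplex z) (f (ofComplex z))) := by
    ext z
    rw [hf.modular, map_smul, smul_eq_mul]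
    rfl
  rw [← e] at hr
  have := hl.unique hr
  simp only [Function.comp_def, ofComplex_apply] at this h0
  rw [mul_one_div, div_eq_iff (pow_ne_zero 2 h0)] at this
  rw [this, zpow_add₀ h0, zpow_sub_one₀ h0]
  simp only [map_smul, map_add, smul_eq_mul, zpow_ofNat]
  ring

/-- This is `L_neg_one_expL1` at x = -cj. The term with `KDeriv` is the one that cancels the
derivative of the cocycle in d/dτ. -/
lemma L_neg_one_K (γ : SL(2, ℤ)) (τ : ℍ) (v : V) :
    A.L (-1) (A.K γ τ v) = (denom γ τ ^ 2) • (A.K γ τ (A.L (-1) v) - A.KDeriv γ τ v) := by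
  have h0 : denom γ τ ≠ 0 := denom_ne_zero γ τ
  have h := A.powL0_apply_of_degree (T := A.L (-1)) (d := 1)
    (fun n v hv => by simpa using A.L_mem (-1) hv) (denom_zpow_ne_zero γ τ (-2)) v
  rw [K, KDeriv, Module.End.mul_apply, Module.End.mul_apply, Module.End.mul_apply,
    Module.End.mul_apply, L_neg_one_expL1, h]
  simp only [LinearMap.sub_apply, LinearMap.smul_apply, map_add, map_sub, map_smul, zpow_neg,
    zpow_ofNat]
  match_scalars <;> field_simp

variable {A} in
-- The `KDeriv` terms of d/dτ and L(-1) cancel; the term from differentiating j^k cancels against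
-- the anomaly of E₂, since (2πik/12)·(12/(2πi)) = k.
lemma IsModularForm.nabla {k N : ℤ} {f : ℍ → V} (hf : A.IsModularForm k N f) :
    A.IsModularForm (k + 2) (N + 1) (A.nabla k f) := by
  have hL : ∀ n, ∀ v ∈ A.gr n, A.L (-1) v ∈ A.gr (n + 1) := fun n v hv => by
    simpa using A.L_mem (-1) hv
  have hN : A.F N ≤ A.F (N + 1) := A.F_mono (by omega)
  refine .of_mem_bddHolo (fun τ => sub_mem (add_mem (hN (hf.vDeriv_mem τ))
    (A.apply_mem_F hL (hf.mem τ))) (Submodule.smul_mem _ _ (hN (hf.mem τ)))) (fun φ => ?_)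
    fun γ τ => ?_
  · have e : (fun τ => φ (A.nabla k f τ)) =
        (fun τ : ℍ => deriv ((fun τ => φ (f τ)) ∘ ofComplex) τ) +
        (fun τ => (φ ∘ₗ A.L (-1)) (f τ)) -
        (2 * Real.pi * Complex.I * k / 12 : ℂ) • (EisensteinSeries.E2 * fun τ => φ (f τ)) := by
      ext τ
      simp only [VertexOperatorAlgebra.nabla, map_sub, map_add, map_smul, Pi.sub_apply,
        Pi.add_apply, Pi.smul_apply, Pi.mul_apply, smul_eq_mul, LinearMap.comp_apply]
      rw [← (hf.hasDerivAt τ φ).deriv, mul_assoc]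
      rfl
    rw [e]
    exact sub_mem (add_mem (deriv_mem_bddHolo (hf.coeff_mem_bddHolo φ))
      (hf.coeff_mem_bddHolo (φ ∘ₗ A.L (-1))))
      (Subalgebra.smul_mem _ (mul_mem E2_mem_bddHolo (hf.coeff_mem_bddHolo φ)) _)
  · have h0 : denom γ τ ≠ 0 := denom_ne_zero γ τ
    have hπ : (Real.pi : ℂ) ≠ 0 := by exact_mod_cast Real.pi_ne_zero
    rw [VertexOperatorAlgebra.nabla, VertexOperatorAlgebra.nabla, hf.vDeriv_smul, hf.modular,
      E2_smul, map_smul, L_neg_one_K, zpow_add₀ h0]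
    simp only [map_add, map_sub, map_smul, zpow_ofNat]
    match_scalars <;> field_simp [Complex.I_ne_zero] <;> ring

/-- The modular derivative as a linear map. -/
def nablaMap (k : ℤ) : A.modForms (k - 2) →ₗ[ℂ] A.modForms k where
  toFun f := ⟨A.nabla (k - 2) f, by
    obtain ⟨N, hf⟩ := f.2
    have := hf.nabla
    rw [sub_add_cancel] at this
    exact ⟨_, this⟩⟩
  map_add' f g := by
    obtain ⟨M, hf⟩ := f.2
    obtain ⟨N, hg⟩ := g.2
    ext τ
    have h : vDeriv ((f : ℍ → V) + (g : ℍ → V)) τ = vDeriv f τ + vDeriv g τ :=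
      vDeriv_eq fun φ => by
        simpa using (hf.hasDerivAt τ φ).fun_add (hg.hasDerivAt τ φ)
    change _ = A.nabla _ _ _ + A.nabla _ _ _
    simp only [nabla, Submodule.coe_add, h, Pi.add_apply, map_add, smul_add]
    abel
  map_smul' c f := by
    obtain ⟨M, hf⟩ := f.2
    ext τ
    have h : vDeriv (c • (f : ℍ → V)) τ = c • vDeriv f τ :=
      vDeriv_eq fun φ => by
        simpa using (hf.hasDerivAt τ φ).const_mul c
    change _ = c • A.nabla _ _ _
    simp only [nabla, Submodule.coe_smul, h, Pi.smul_apply, map_smul, smul_add, smul_sub]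
    rw [smul_comm c]

/-! ### Forms with quasi-primary derivative -/

lemma coe_proj_of_degree {T : V →ₗ[ℂ] V} {d : ℤ} (hT : ∀ n, ∀ v ∈ A.gr n, T v ∈ A.gr (n + d))
    (n : ℤ) (v : V) : (A.proj (n + d) (T v) : V) = T (A.proj n v) := by
  induction v using A.homogeneous_induction with
  | zero => simp
  | add v w hv hw => simp [hv, hw]
  | mem m v hv =>
    by_cases h : m = n
    · subst h
      rw [A.proj_of_mem hv, A.proj_of_mem (hT m v hv)]
    · rw [A.proj_of_mem_ne h hv, A.proj_of_mem_ne (by omega) (hT m v hv)]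
      simp

lemma proj_eq_zero_of_mem_F {n N : ℤ} (h : N < n) {v : V} (hv : v ∈ A.F N) : A.proj n v = 0 := by
  suffices A.F N ≤ LinearMap.ker (A.proj n) from this hv
  exact iSup_le fun m w hw => A.proj_of_mem_ne (by have := m.2; omega) hw

variable {A} in
lemma IsModularForm.map_vDeriv_eq_zero {k N : ℤ} {f : ℍ → V} (hf : A.IsModularForm k N f)
    {W : Type*} [AddCommGroup W] [Module ℂ W] (T : V →ₗ[ℂ] W) (hT : ∀ τ, T (f τ) = 0) (τ : ℍ) :
    T (vDeriv f τ) = 0 := by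
  rw [← Module.forall_dual_apply_eq_zero_iff ℂ]
  intro φ
  have h := hf.hasDerivAt τ (φ ∘ₗ T)
  simp only [LinearMap.comp_apply, hT, map_zero] at h
  exact h.unique (hasDerivAt_const _ _)

variable {A} in
/-- A form whose modular derivative is quasi-primary takes values in `V_0`. -/
lemma IsModularForm.mem_gr_zero (hA : A.IsCFTType) {k N : ℤ} {f : ℍ → V}
    (hf : A.IsModularForm k N f) (h : ∀ τ, A.L 1 (A.nabla k f τ) = 0) (τ : ℍ) : f τ ∈ A.gr 0 := by
  -- Descending induction on n from N: once f_{n+1} = 0 identically, the weight-n part of L(1)∇f is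
  -- L(1)L(-1)f_n.
  have key : ∀ j : ℕ, ∀ n : ℤ, 1 ≤ n → N < n + j → ∀ τ, A.proj n (f τ) = 0 := by
    intro j
    induction j with
    | zero => intro n _ hn τ; exact A.proj_eq_zero_of_mem_F (by simpa using hn) (hf.mem τ)
    | succ j ih =>
      intro n hn hN τ
      have hz := ih (n + 1) (by omega) (by push_cast at hN; omega)
      refine Subtype.ext (A.eq_zero_of_L_one_L_neg_one hA hn (A.proj n (f τ)).2 ?_)
      have h1 := A.coe_proj_of_degree (T := A.L 1) (d := -1) (fun n v hv => A.L_mem 1 hv) (n + 1)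
        (A.nabla k f τ)
      rw [h, map_zero, VertexOperatorAlgebra.nabla, map_sub, map_add, map_smul, hz,
        hf.map_vDeriv_eq_zero _ hz, zero_add, smul_zero, sub_zero, A.coe_proj_of_degree (T := A.L (-1)) (d := 1) fun n v hv => by
          simpa using A.L_mem (-1) hv] at h1
      exact h1.symm
  have : f τ - A.proj 0 (f τ) = 0 := A.eq_zero_of_proj fun n => by
    rw [map_sub, sub_eq_zero]
    rcases lt_trichotomy n 0 with hn | rfl | hn
    · exact Subtype.ext (((A.gr_neg hA hn).le (A.proj n _).2).trans
        ((A.gr_neg hA hn).le (A.proj n _).2).symm)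
    · rw [A.proj_of_mem (A.proj 0 (f τ)).2]
    · rw [key (N - n + 1).toNat n hn (by omega), A.proj_of_mem_ne hn.ne (A.proj 0 (f τ)).2]
  rw [sub_eq_zero.mp this]
  exact (A.proj 0 (f τ)).2

lemma mem_scalarForms (hA : A.IsCFTType) {k : ℤ} {f : A.modForms k}
    (hf : ∀ τ, (f : ℍ → V) τ ∈ A.gr 0) : f ∈ A.scalarForms k := by
  obtain ⟨ψ, hψ, h1, hvac⟩ := A.exists_vacFunctional hA
  have hm := A.coeffMap_mem hψ f
  rw [mul_zero, sub_zero] at hm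
  refine ⟨toModularForm k ⟨_, hm⟩, Subtype.ext <| funext fun τ => ?_⟩
  change ψ (A.expL1 (-twist τ) ((f : ℍ → V) τ)) • A.vac = _
  rw [← hvac _ (hf τ), map_smul, expL1_vac, hvac _ (hf τ), hvac _ (hf τ)]

/-- One direction makes the induced map on quotients well defined, the other makes it injective. -/
lemma nablaMap_mem_quasiPrimaryForms_iff (hA : A.IsCFTType) {k : ℤ} (f : A.modForms (k - 2)) :
    A.nablaMap k f ∈ A.quasiPrimaryForms k ↔ f ∈ A.scalarForms (k - 2) := by
  constructor
  · intro h
    obtain ⟨N, hf⟩ := f.2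
    exact A.mem_scalarForms hA (hf.mem_gr_zero hA h)
  · rintro ⟨F, rfl⟩ τ
    obtain ⟨N, hf⟩ := (A.vacForm (k - 2) F).2
    have h1 : ∀ τ, A.L 1 ((A.vacForm (k - 2) F : ℍ → V) τ) = 0 := fun τ => by
      change A.L 1 (F τ • A.vac) = 0
      rw [map_smul, A.L_vac (by norm_num), smul_zero]
    have h2 : A.L (-1) ((A.vacForm (k - 2) F : ℍ → V) τ) = 0 := by
      change A.L (-1) (F τ • A.vac) = 0
      rw [map_smul, A.L_vac le_rfl, smul_zero]
    change A.L 1 (A.nabla (k - 2) _ τ) = 0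
    rw [nabla, map_sub, map_add, map_smul, h1, h2, hf.map_vDeriv_eq_zero _ h1]
    simp

/-! ### Dimension count -/

lemma finrank_scalarForms (k : ℤ) :
    Module.finrank ℂ (A.scalarForms k) = Module.finrank ℂ (ModularForm 𝒮ℒ k) := by
  refine LinearMap.finrank_range_of_inj fun F G h => DFunLike.ext _ _ fun τ => ?_
  have := congrFun (congrArg Subtype.val h) τ
  exact smul_left_injective ℂ A.vac_ne_zero this

/-- The defect `dim V_1 - dim ker L(1)|_{V_1}`. -/
def defect : ℤ :=
  (Module.finrank ℂ (A.gr 1) : ℤ) -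
    Module.finrank ℂ (LinearMap.ker ((A.L 1).domRestrict (A.gr 1)))

lemma defect_eq_finrank_range :
    A.defect = Module.finrank ℂ (LinearMap.range ((A.L 1).domRestrict (A.gr 1))) := by
  have := A.finite_gr 1
  rw [defect, ← ((A.L 1).domRestrict (A.gr 1)).finrank_range_add_finrank_ker]
  push_cast
  ring

lemma defect_eq_zero (h : ∀ v ∈ A.gr 1, A.L 1 v = 0) : A.defect = 0 := by
  have : (A.L 1).domRestrict (A.gr 1) = 0 := LinearMap.ext fun v => h v v.2
  rw [defect_eq_finrank_range, this, LinearMap.range_zero, finrank_bot, Nat.cast_zero]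

lemma defect_eq_one (hA : A.IsCFTType) (h : ∃ v ∈ A.gr 1, A.L 1 v ≠ 0) : A.defect = 1 := by
  obtain ⟨v, hv, hv0⟩ := h
  have hle : LinearMap.range ((A.L 1).domRestrict (A.gr 1)) ≤ Submodule.span ℂ {A.vac} := by
    rintro _ ⟨u, rfl⟩
    rw [← hA]
    simpa using A.L_mem 1 u.2
  have h1 := Submodule.finrank_mono hle
  have h2 : LinearMap.range ((A.L 1).domRestrict (A.gr 1)) ≠ ⊥ := fun h => hv0 <| by
    have : A.L 1 v ∈ LinearMap.range ((A.L 1).domRestrict (A.gr 1)) := ⟨⟨v, hv⟩, rfl⟩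
    simpa [h] using this
  have h3 : 0 < Module.finrank ℂ (LinearMap.range ((A.L 1).domRestrict (A.gr 1))) := by
    have := Submodule.finiteDimensional_of_le hle
    exact Nat.pos_of_ne_zero fun h => h2 (Submodule.finrank_eq_zero.mp h)
  rw [finrank_span_singleton A.vac_ne_zero] at h1
  rw [defect_eq_finrank_range]
  omega

/-- Rank–nullity for L(1) : M_k(V) → M_{k-2}(V). The image has codimension dim M_{k-2} when the
defect is 0, and codimension 0 when it is 1. -/
lemma finrank_modForms (hA : A.IsCFTType) (k : ℤ) :
    (Module.finrank ℂ (A.modForms k) : ℤ) = Module.finrank ℂ (A.quasiPrimaryForms k) +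
      (Module.finrank ℂ (A.modForms (k - 2)) - Module.finrank ℂ (ModularForm 𝒮ℒ (k - 2))) +
      Module.finrank ℂ (ModularForm 𝒮ℒ (k - 2)) * A.defect := by
  have := A.finite_modForms hA k
  have := A.finite_modForms hA (k - 2)
  have h := (A.lowering k).finrank_range_add_finrank_ker
  rw [ker_lowering] at h
  by_cases h1 : ∀ v ∈ A.gr 1, A.L 1 v = 0
  · obtain ⟨ψ, hψ, hψ1, hvac⟩ := A.exists_vacFunctional hA
    have h2 := Submodule.finrank_add_eq_of_isCompl (A.isCompl_scalarForms hψ hψ1 (k - 2))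
    rw [finrank_scalarForms] at h2
    rw [A.range_lowering_eq_ker hA k h1 hψ hvac] at h
    rw [A.defect_eq_zero h1]
    omega
  · push Not at h1
    rw [A.range_lowering_eq_top hA k h1, finrank_top] at h
    rw [A.defect_eq_one hA h1]
    omega

lemma isInternal_three {E : Type*} [AddCommGroup E] [Module ℂ E] {P Q R : Submodule ℂ E}
    (h : Disjoint P Q) (h' : IsCompl (P ⊔ Q) R) : DirectSum.IsInternal ![P, Q, R] := by
  rw [DirectSum.isInternal_submodule_iff_iSupIndep_and_iSup_eq_top]
  constructor
  · intro i
    fin_cases i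
    · refine (h.disjoint_sup_right_of_disjoint_sup_left h'.disjoint).mono_right
        (iSup₂_le fun j hj => ?_)
      fin_cases j
      · exact absurd rfl hj
      · exact le_sup_left
      · exact le_sup_right
    · refine (h.symm.disjoint_sup_right_of_disjoint_sup_left
        (by rw [sup_comm]; exact h'.disjoint)).mono_right (iSup₂_le fun j hj => ?_)
      fin_cases j
      · exact le_sup_left
      · exact absurd rfl hj
      · exact le_sup_right
    · refine h'.disjoint.symm.mono_right (iSup₂_le fun j hj => ?_)
      fin_cases j
      · exact le_sup_left
      · exact le_sup_right
      · exact absurd rfl hj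
  · rw [eq_top_iff, ← h'.sup_eq_top]
    exact sup_le (sup_le (le_iSup ![P, Q, R] 0) (le_iSup ![P, Q, R] 1)) (le_iSup ![P, Q, R] 2)

lemma finrank_of_isInternal_three {E : Type*} [AddCommGroup E] [Module ℂ E] [Module.Finite ℂ E]
    {P Q R : Submodule ℂ E} (h : DirectSum.IsInternal ![P, Q, R]) :
    Module.finrank ℂ E = Module.finrank ℂ P + Module.finrank ℂ Q + Module.finrank ℂ R := by
  rw [← (LinearEquiv.ofBijective (DirectSum.coeLinearMap ![P, Q, R]) h).finrank_eq,
    Module.finrank_directSum, Fin.sum_univ_three]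
  rfl

end VertexOperatorAlgebra

end

theorem mainTheorem11 {V : Type*} [AddCommGroup V] [Module ℂ V] (A : VertexOperatorAlgebra V)
    (hA : A.IsCFTType) (k : ℤ) :
    Module.Finite ℂ (A.modForms k) ∧
    -- `∇_{k-2}` is a linear map `M_{k-2}(V) → M_k(V)`
    ∃ D : A.modForms (k - 2) →ₗ[ℂ] A.modForms k,
      (∀ f : A.modForms (k - 2), (D f : ℍ → V) = A.nabla (k - 2) f) ∧
      -- it induces an injective map `M_{k-2}(V) / M_{k-2} → M_k(V) / M_k(QP)`
      ∃ h : A.scalarForms (k - 2) ≤ (A.quasiPrimaryForms k).comap D,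
        Function.Injective (Submodule.mapQ _ _ D h) ∧
        -- the decomposition of the quotient
        (∃ R : Submodule ℂ (A.modForms k ⧸ A.quasiPrimaryForms k),
          IsCompl (LinearMap.range (Submodule.mapQ _ _ D h)) R) ∧
        (∀ R : Submodule ℂ (A.modForms k ⧸ A.quasiPrimaryForms k),
          IsCompl (LinearMap.range (Submodule.mapQ _ _ D h)) R →
          (Module.finrank ℂ R : ℤ) = Module.finrank ℂ (ModularForm 𝒮ℒ (k - 2)) *
            ((Module.finrank ℂ (A.gr 1) : ℤ) -
              Module.finrank ℂ (LinearMap.ker ((A.L 1).domRestrict (A.gr 1)))) ∧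
          ((∃ B : LinearMap.BilinForm ℂ V, A.IsInvariantForm B ∧ B.Nondegenerate) → R = ⊥)) ∧
        -- the decomposition of `M_k(V)`, for every realization `W` of `M_{k-2}(V) / M_{k-2}`
        ∀ W : Submodule ℂ (A.modForms (k - 2)), IsCompl (A.scalarForms (k - 2)) W →
          (∃ R : Submodule ℂ (A.modForms k),
            DirectSum.IsInternal ![A.quasiPrimaryForms k, W.map D, R]) ∧
          ∀ R : Submodule ℂ (A.modForms k),
            DirectSum.IsInternal ![A.quasiPrimaryForms k, W.map D, R] →
            (Module.finrank ℂ R : ℤ) = Module.finrank ℂ (ModularForm 𝒮ℒ (k - 2)) *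
              ((Module.finrank ℂ (A.gr 1) : ℤ) -
                Module.finrank ℂ (LinearMap.ker ((A.L 1).domRestrict (A.gr 1)))) ∧
            ((∃ B : LinearMap.BilinForm ℂ V, A.IsInvariantForm B ∧ B.Nondegenerate) →
              R = ⊥) := by
  have := A.finite_modForms hA k
  have := A.finite_modForms hA (k - 2)
  have hdim := A.finrank_modForms hA k
  have hform : (∃ B : LinearMap.BilinForm ℂ V, A.IsInvariantForm B ∧ B.Nondegenerate) →
      A.defect = 0 := fun ⟨B, hB, hn⟩ => A.defect_eq_zero fun v hv => hB.L_one_eq_zero hn hA hv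
  have hbot {E : Type _} [AddCommGroup E] [Module ℂ E] [Module.Finite ℂ E] {R : Submodule ℂ E}
      (h : (Module.finrank ℂ R : ℤ) = Module.finrank ℂ (ModularForm 𝒮ℒ (k - 2)) * A.defect) :
      (∃ B : LinearMap.BilinForm ℂ V, A.IsInvariantForm B ∧ B.Nondegenerate) → R = ⊥ := fun hB => by
    rw [hform hB, mul_zero, Nat.cast_eq_zero] at h
    exact Submodule.finrank_eq_zero.mp h
  have hmem := fun f => A.nablaMap_mem_quasiPrimaryForms_iff hA (k := k) f
  refine ⟨inferInstance, A.nablaMap k, fun f => rfl, fun f hf => (hmem f).mpr hf, ?_⟩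
  have hinj : Function.Injective (Submodule.mapQ (A.scalarForms (k - 2)) (A.quasiPrimaryForms k)
      (A.nablaMap k) fun f hf => (hmem f).mpr hf) := by
    rw [injective_iff_map_eq_zero]
    intro x
    obtain ⟨f, rfl⟩ := Submodule.Quotient.mk_surjective _ x
    rw [Submodule.mapQ_apply, Submodule.Quotient.mk_eq_zero, Submodule.Quotient.mk_eq_zero]
    exact (hmem f).mp
  have hscal := A.finrank_scalarForms (k - 2)
  refine ⟨hinj, Submodule.exists_isCompl _, fun R hR => ?_, fun W hW => ?_⟩
  -- By injectivity dim R = (dim M_k(V) - dim M_k(QP)) - (dim M_{k-2}(V) - dim M_{k-2}), which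
  -- `hdim` evaluates.
  · suffices h : (Module.finrank ℂ R : ℤ) =
        Module.finrank ℂ (ModularForm 𝒮ℒ (k - 2)) * A.defect from ⟨h, hbot h⟩
    have h1 := Submodule.finrank_add_eq_of_isCompl hR
    rw [LinearMap.finrank_range_of_inj hinj] at h1
    have h2 := (A.scalarForms (k - 2)).finrank_quotient_add_finrank
    have h3 := (A.quasiPrimaryForms k).finrank_quotient_add_finrank
    omega
  -- This gives both the injectivity of ∇ on W and the independence of ∇(W) from M_k(QP).
  · have hker : ∀ w ∈ W, A.nablaMap k w ∈ A.quasiPrimaryForms k → w = 0 := fun w hw h =>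
      Submodule.disjoint_def.mp hW.disjoint w ((hmem w).mp h) hw
    refine ⟨?_, fun R hR => ?_⟩
    · have hd : Disjoint (A.quasiPrimaryForms k) (W.map (A.nablaMap k)) := by
        rw [Submodule.disjoint_def]
        rintro _ h ⟨w, hw, rfl⟩
        rw [hker w hw h, map_zero]
      obtain ⟨R, hR⟩ := Submodule.exists_isCompl (A.quasiPrimaryForms k ⊔ W.map (A.nablaMap k))
      exact ⟨R, VertexOperatorAlgebra.isInternal_three hd hR⟩
    · suffices h : (Module.finrank ℂ R : ℤ) =
          Module.finrank ℂ (ModularForm 𝒮ℒ (k - 2)) * A.defect from ⟨h, hbot h⟩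
      have h1 := VertexOperatorAlgebra.finrank_of_isInternal_three hR
      have h2 : Module.finrank ℂ (W.map (A.nablaMap k)) = Module.finrank ℂ W := by
        rw [← LinearMap.range_domRestrict]
        refine LinearMap.finrank_range_of_inj ?_
        rw [injective_iff_map_eq_zero]
        intro w hw
        refine Subtype.ext (hker w w.2 ?_)
        rw [show A.nablaMap k w = 0 from hw]
        exact zero_mem _
      have h3 := Submodule.finrank_add_eq_of_isCompl hW
      omega
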